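/- Let $p$ be a prime, let $K$ be a $p$-adic local field (a finite extension of $\mathbb{Q}_p$) with valuation ring $\mathcal{O}$ and residue field $k$, and let $G$ be a finite group such that $K$ contains the $|G|$-th roots of unity. Suppose that $G = N \rtimes P$, where $N$ is a normal subgroup of order prime to $p$ and $P$ is a cyclic $p$-Sylow subgroup of $G$. Let $\mathrm{Irr}(G)$ be the set of isomorphism classes of irreducible representations of $G$ over $K$. The Brauer graph has vertex set $\mathrm{Irr}(G)$, with two distinct classes joined by an edge if some simple $k[G]$-module is a composition factor of $\Lambda \otimes_{\mathcal{O}} k$ for $G$-stable $\mathcal{O}$-lattices $\Lambda$ in representatives of both classes; its connected components are the blocks. For a block $B$ put $$\tilde e_B = \sum_{\sigma \in B} e_\sigma \in K[G], \qquad e_\sigma = \frac{\dim \sigma}{|G|} \sum_{g \in G} \chi_\sigma(g)\,[g^{-1}],$$ where $\chi_\sigma$ is the character of $\sigma$. Let $H \le N$ be a subgroup and let $\rho : G \to \mathrm{GL}_n(K)$ be a representation such that $\rho|_H$ is irreducible. Let $\rho_{\mathcal{O}}$ be any $G$-stable $\mathcal{O}$-lattice in $\rho$, and let $B$ be the block that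 contains $\rho$. Let $L \le G$ be a subgroup and let $\psi : L \to \mathcal{O}^\times$ be a character of order prime to $p$ such that the $K[G]$-module $\mathrm{Ind}_L^G(\psi \otimes_{\mathcal{O}} K)$ is multiplicity free, that is, a direct sum of pairwise non-isomorphic simple modules. Then $\tilde e_B$ is a central element of $\mathcal{O}[G]$, and there is a surjective homomorphism of $\mathcal{O}[G]$-modules $$\tilde e_B\,\mathrm{Ind}_H^G(\rho_{\mathcal{O}}|_H) \twoheadrightarrow \tilde e_B\,\mathrm{Ind}_L^G \psi .$$ -/

import Mathlib

open scoped ValuativeRel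

namespace PNilpotent

noncomputable section

/-! ### Central idempotents, multiplicity-free modules, composition factors -/

/-- Multiplication by a central element `e` of `A`, as an `A`-linear endomorphism of `M`. -/
def centralMul {A : Type*} [Ring A] (e : Subring.center A)
    (M : Type*) [AddCommGroup M] [Module A M] : M →ₗ[A] M where
  toFun m := (e : A) • m
  map_add' := smul_add _
  map_smul' a m := by
    simp only [RingHom.id_apply, smul_smul]
    rw [Subring.mem_center_iff.mp e.2 a]

/-- The submodule `e M` of `M`, for `e` in the center of `A`. -/
def centralPart {A : Type*} [Ring A] (e : Subring.center A)
    (M : Type*) [AddCommGroup M] [Module A M] : Submodule A M :=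
  LinearMap.range (centralMul e M)

/-- `M` is multiplicity free: it is an (internal) direct sum of pairwise non-isomorphic
simple submodules. -/
def IsMultiplicityFree (A : Type*) [Ring A] (M : Type*) [AddCommGroup M] [Module A M] : Prop :=
  ∃ 𝒮 : Set (Submodule A M), sSupIndep 𝒮 ∧ sSup 𝒮 = ⊤ ∧ (∀ S ∈ 𝒮, IsSimpleModule A S) ∧
    ∀ S ∈ 𝒮, ∀ T ∈ 𝒮, Nonempty (S ≃ₗ[A] T) → S = T

/-- The simple module `S` is a composition factor of `M`, that is, a simple module isomorphic to
a subquotient `N₂ / N₁` of `M`. -/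
def IsCompositionFactor (A : Type*) [Ring A] (S M : Type*) [AddCommGroup S] [Module A S]
    [AddCommGroup M] [Module A M] : Prop :=
  IsSimpleModule A S ∧ ∃ N₁ N₂ : Submodule A M, N₁ ≤ N₂ ∧
    Nonempty (S ≃ₗ[A] (N₂ ⧸ N₁.submoduleOf N₂))

/-! ### Representations -/

/-- A representation whose restriction to a subgroup is irreducible is irreducible. -/
theorem irreducible_of_restrict {G K V : Type*} [Group G] [Field K] [AddCommGroup V] [Module K V]
    {ρ : Representation K G V} {H : Subgroup G}
    (h : Representation.IsIrreducible (ρ.comp H.subtype)) : ρ.IsIrreducible := by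
  refine @IsSimpleOrder.mk _ _ _ ⟨⊥, ⊤, fun hbt => ?_⟩ fun W => ?_
  · obtain ⟨a, b, hab⟩ := h.toNontrivial
    have hV : (⊥ : Submodule K V) = ⊤ := congrArg Subrepresentation.toSubmodule hbt
    refine hab (Subrepresentation.toSubmodule_injective ?_)
    exact (eq_bot_iff.mpr (le_top.trans_eq hV.symm)).trans
      (eq_bot_iff.mpr (le_top.trans_eq hV.symm)).symm
  · let W' : Subrepresentation (ρ.comp H.subtype) :=
      ⟨W.toSubmodule, fun g _ hv => W.apply_mem_toSubmodule g hv⟩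
    rcases h.eq_bot_or_eq_top W' with hW | hW
    · left
      apply Subrepresentation.toSubmodule_injective
      exact (congrArg Subrepresentation.toSubmodule hW : W.toSubmodule = (⊥ : Submodule K V))
    · right
      apply Subrepresentation.toSubmodule_injective
      exact (congrArg Subrepresentation.toSubmodule hW : W.toSubmodule = (⊤ : Submodule K V))

/-- The representation on `R` itself attached to a character `ψ : L → Rˣ`. -/
def charRep {L R : Type*} [Monoid L] [CommRing R] (ψ : L →* Rˣ) : Representation R L R :=
  ((Algebra.lmul R R : R →ₐ[R] Module.End R R) : R →* Module.End R R).comp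
    ((Units.coeHom R).comp ψ)

/-- The `R[G]`-module `Ind_H^G σ`, for a representation `σ` of a subgroup `H` of `G`. -/
abbrev IndModule {R G V : Type*} [CommRing R] [Group G] [AddCommGroup V] [Module R V]
    (H : Subgroup G) (σ : Representation R H V) : Type _ :=
  (Representation.ind H.subtype σ).asModule

/-! ### Lattices and their reductions -/

/-- An `O`-lattice in the `K`-representation `ρ`: a finitely generated `O`-submodule of `V` that
spans `V` over `K` and is stable under `G`. -/
structure StableLattice (O : Type*) {K G V : Type*} [CommRing O] [Field K] [Algebra O K] [Monoid G]
    [AddCommGroup V] [Module K V] [Module O V] [IsScalarTower O K V]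
    (ρ : Representation K G V) where
  /-- The underlying submodule. -/
  carrier : Submodule O V
  fg : carrier.FG
  span_eq_top : Submodule.span K (carrier : Set V) = ⊤
  stable : ∀ (g : G), ∀ v ∈ carrier, ρ g v ∈ carrier

namespace StableLattice

variable {O K G V : Type*} [CommRing O] [Field K] [Algebra O K] [Monoid G]
  [AddCommGroup V] [Module K V] [Module O V] [IsScalarTower O K V] {ρ : Representation K G V}

/-- The representation of `G` over `O` on a lattice. -/
def rep (Λ : StableLattice O ρ) : Representation O G Λ.carrier where
  toFun g := ((ρ g).restrictScalars O).restrict (Λ.stable g)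
  map_one' := by ext v; simp
  map_mul' g h := by
    ext v
    exact congrFun (congrArg DFunLike.coe (map_mul ρ g h)) (v : V)

/-- The reduction `k ⊗_O Λ` of a lattice, a representation of `G` over the residue field `k`. -/
def reduction [IsLocalRing O] (Λ : StableLattice O ρ) :
    Representation (IsLocalRing.ResidueField O) G
      (TensorProduct O (IsLocalRing.ResidueField O) Λ.carrier) :=
  (Module.End.baseChangeHom O (IsLocalRing.ResidueField O) Λ.carrier :
    Module.End O Λ.carrier →* _).comp Λ.rep

end StableLattice

/-! ### Irreducible representations, the Brauer graph and block idempotents -/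

/-- An irreducible representation `G → GL_n(K)`. -/
structure IrrRep (K G : Type*) [Field K] [Group G] where
  /-- The dimension. -/
  dim : ℕ
  /-- The representation. -/
  rep : Representation K G (Fin dim → K)
  irreducible : rep.IsIrreducible

/-- Isomorphism of irreducible representations. -/
instance irrSetoid (K G : Type*) [Field K] [Group G] : Setoid (IrrRep K G) where
  r ρ σ := Nonempty (Representation.Equiv ρ.rep σ.rep)
  iseqv := ⟨fun _ => ⟨.refl _⟩, fun ⟨φ⟩ => ⟨φ.symm⟩, fun ⟨φ⟩ ⟨χ⟩ => ⟨φ.trans χ⟩⟩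

/-- `Irr(G)`: the set of isomorphism classes of irreducible representations of `G` over `K`. -/
abbrev Irr (K G : Type*) [Field K] [Group G] : Type _ := Quotient (irrSetoid K G)

/-- The element `e_ρ = (dim ρ / #G) ∑_g χ_ρ(g) [g⁻¹]` of `K[G]`. -/
def IrrRep.idempotent {K G : Type*} [Field K] [Group G] [Fintype G] (ρ : IrrRep K G) :
    MonoidAlgebra K G :=
  ((ρ.dim : K) / (Fintype.card G : K)) •
    ∑ g : G, MonoidAlgebra.single g⁻¹ (ρ.rep.character g)

/-- The element `e_x` of `K[G]` attached to an isomorphism class `x`. -/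
def Irr.idempotent {K G : Type*} [Field K] [Group G] [Fintype G] (x : Irr K G) :
    MonoidAlgebra K G :=
  Quotient.lift IrrRep.idempotent (by
    rintro ρ σ ⟨φ⟩
    have hd : ρ.dim = σ.dim := by simpa using φ.toLinearEquiv.finrank_eq
    simp only [IrrRep.idempotent, hd, Representation.char_iso φ]) x

/-- The simple `k[G]`-module attached to `η` occurs in the reduction of `ρ` modulo the maximal
ideal of `O` (the decomposition number `d_{ρ,η}` is not zero): it is a composition factor of the
reduction of a lattice in `ρ`. -/
def IsModularConstituent (O : Type*) {K G : Type*} [CommRing O] [IsLocalRing O] [Field K]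
    [Algebra O K] [Group G] (η : IrrRep (IsLocalRing.ResidueField O) G) (ρ : IrrRep K G) : Prop :=
  ∃ Λ : StableLattice O ρ.rep,
    IsCompositionFactor (MonoidAlgebra (IsLocalRing.ResidueField O) G)
      η.rep.asModule Λ.reduction.asModule

/-- The Brauer graph: the vertex set is `Irr(G)`, and two distinct classes are joined by an edge
if some simple `k[G]`-module occurs in the reductions of both. -/
def brauerGraph (O K G : Type*) [CommRing O] [IsLocalRing O] [Field K] [Algebra O K] [Group G] :
    SimpleGraph (Irr K G) where
  Adj x y := x ≠ y ∧ ∃ ρ σ : IrrRep K G, ⟦ρ⟧ = x ∧ ⟦σ⟧ = y ∧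
    ∃ η : IrrRep (IsLocalRing.ResidueField O) G,
      IsModularConstituent O η ρ ∧ IsModularConstituent O η σ
  symm := ⟨fun _ _ ⟨hxy, ρ, σ, hρ, hσ, η, h₁, h₂⟩ =>
    ⟨hxy.symm, σ, ρ, hσ, hρ, η, h₂, h₁⟩⟩
  loopless := ⟨fun _ h => h.1 rfl⟩

/-- `Bl(G)`: the blocks are the connected components of the Brauer graph. -/
abbrev Block (O K G : Type*) [CommRing O] [IsLocalRing O] [Field K] [Algebra O K] [Group G] :
    Type _ :=
  (brauerGraph O K G).ConnectedComponent

/-- The block that contains the irreducible representation `ρ`. -/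
def blockOf (O : Type*) {K G : Type*} [CommRing O] [IsLocalRing O] [Field K] [Algebra O K]
    [Group G] (ρ : IrrRep K G) : Block O K G :=
  (brauerGraph O K G).connectedComponentMk ⟦ρ⟧

/-- The sum of the `e_ρ` over the members `ρ` of the block `B`, in `K[G]`. -/
def blockIdempotent {O K G : Type*} [CommRing O] [IsLocalRing O] [Field K] [Algebra O K]
    [Group G] [Fintype G] (B : Block O K G) : MonoidAlgebra K G :=
  ∑ᶠ x ∈ B.supp, Irr.idempotent x

end

end PNilpotent

open scoped ValuativeRel
namespace PNilpotent

noncomputable section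

/-! Write k for the residue field, R for the matrix representation on the lattice, and Φ for
`schurLift`. Because |N| is a unit in 𝒪, the part of 𝒪[N] that belongs to ρ already splits over 𝒪.
Indeed ρ restricted to N is irreducible, and its lattice reduces to a simple k[N]-module
(`colRep_isSimpleModule`). The endomorphisms of this module are scalars because X^|N| − 1 splits
over k (`exists_eq_smul_of_isSimpleModule`). By Nakayama, and then by clearing denominators, the
commutant of R(N) is scalar over 𝒪 and over K. Schur orthogonality then makes Φ a multiplicative
section M_n(𝒪) → 𝒪[N] of R, and Φ(1) is a central idempotent of 𝒪[G].

The elements g Φ(R(g)⁻¹) (`twistElement`) commute with the image of Φ and depend only on g modulo N.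
Hence the simple K[G]-modules on which Φ(1) acts as the identity are twists of ρ by characters of
the cyclic p-group G/N (`exists_twist_of_isSimpleModule`). Such characters are trivial modulo the
maximal ideal, so all these twists lie in the block of ρ. Conversely, Φ(1) is an integral central
idempotent, so it acts as the identity on the whole block. Adding up the idempotents of the twists
gives ẽ_B = Φ(1) (`blockIdempotent_blockOf`).

For the surjection, let ε be the projection onto the ψ-eigenspace of L ∩ N (`charProj`). In Ind ψ,
with its generator, Φ(T)·generator depends only on Tε. For a row vector f the map v ↦ Φ(v ⊗
f)·generator is N-equivariant, so it extends to Ind_H^G, and it is onto the Φ(1)-part as soon as fε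
generates the row space of ε under R(L). By Nakayama this may be checked over k. There L is
generated by one element c modulo L ∩ N, and x = (ψ(c)⁻¹R(c) − 1)ε is nilpotent, so the row space
has to be cyclic over k[x]. This holds when the centralizer of x in the corner of ε is commutative
(`exists_vecMul_mem_span_of_commute`). Multiplicity freeness gives the commutativity over K
(`mul_comm_of_isMultiplicityFree`), hence over 𝒪, and it passes to k because matrices commuting with
R(L) lift (`exists_lift_of_schurRel`). -/

/-! ### Matrix coefficients and the section Φ of a representation. -/

open scoped Classical in
/-- The element `w * ∑_{g ∈ N} tr(R(g) T) [g⁻¹]` of the group algebra. -/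
def schurLift {A G : Type*} [CommRing A] [Group G] [Fintype G] {n : ℕ}
    (R : G →* Matrix (Fin n) (Fin n) A) (N : Subgroup G) (w : A) :
    Matrix (Fin n) (Fin n) A →ₗ[A] MonoidAlgebra A G where
  toFun T := ∑ g : G, MonoidAlgebra.single g (if g ∈ N then w * (R g⁻¹ * T).trace else 0)
  map_add' S T := by
    rw [← Finset.sum_add_distrib]
    refine Finset.sum_congr rfl fun g _ => ?_
    rw [← MonoidAlgebra.single_add]
    split_ifs <;> simp [mul_add]
  map_smul' a T := by
    rw [RingHom.id_apply, Finset.smul_sum]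
    refine Finset.sum_congr rfl fun g _ => ?_
    rw [MonoidAlgebra.smul_single]
    split_ifs <;> simp [mul_left_comm]

open scoped Classical in
/-- Schur's orthogonality relations for the matrix coefficients of `R` on `N`. -/
def SchurRel {A G : Type*} [CommRing A] [Group G] [Fintype G] {n : ℕ}
    (R : G →* Matrix (Fin n) (Fin n) A) (N : Subgroup G) (w : A) : Prop :=
  ∀ i j k l, w * ∑ g : G, (if g ∈ N then R g⁻¹ i j * R g k l else 0) =
    (1 : Matrix (Fin n) (Fin n) A) k j * (1 : Matrix (Fin n) (Fin n) A) i l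

/-- The extension of a matrix representation to the group algebra. -/
abbrev groupAlgebraEval {A G : Type*} [CommRing A] [Group G] {n : ℕ}
    (R : G →* Matrix (Fin n) (Fin n) A) : MonoidAlgebra A G →ₐ[A] Matrix (Fin n) (Fin n) A :=
  MonoidAlgebra.lift A _ G R

/-- Base change of a matrix representation. -/
def mapRep {A B G : Type*} [CommRing A] [CommRing B] [Group G] {n : ℕ} (f : A →+* B)
    (R : G →* Matrix (Fin n) (Fin n) A) : G →* Matrix (Fin n) (Fin n) B :=
  (f.mapMatrix : Matrix (Fin n) (Fin n) A →+* Matrix (Fin n) (Fin n) B).toMonoidHom.comp R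

@[simp]
theorem mapRep_apply {A B G : Type*} [CommRing A] [CommRing B] [Group G] {n : ℕ} (f : A →+* B)
    (R : G →* Matrix (Fin n) (Fin n) A) (g : G) : mapRep f R g = (R g).map f := rfl

section

variable {A G : Type*} [CommRing A] [Group G] [Fintype G] {n : ℕ}
  {R : G →* Matrix (Fin n) (Fin n) A} {N : Subgroup G} {w : A}

open scoped Classical in
theorem coeff_schurLift (T : Matrix (Fin n) (Fin n) A) (x : G) :
    (schurLift R N w T).coeff x = if x ∈ N then w * (R x⁻¹ * T).trace else 0 := by
  simp [schurLift, MonoidAlgebra.coeff_sum, Finsupp.finsetSum_apply, MonoidAlgebra.coeff_single,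
    Finsupp.single_apply]

theorem single_mul_schurLift {h : G} (hh : h ∈ N) (T : Matrix (Fin n) (Fin n) A) :
    MonoidAlgebra.single h 1 * schurLift R N w T = schurLift R N w (R h * T) := by
  ext x
  rw [coeff_schurLift, MonoidAlgebra.coeff_single_mul_apply, coeff_schurLift, one_mul,
    N.mul_mem_cancel_left (N.inv_mem hh), mul_inv_rev, inv_inv, map_mul, Matrix.mul_assoc]

theorem schurLift_mul_single {h : G} (hh : h ∈ N) (T : Matrix (Fin n) (Fin n) A) :
    schurLift R N w T * MonoidAlgebra.single h 1 = schurLift R N w (T * R h) := by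
  ext x
  rw [coeff_schurLift, MonoidAlgebra.coeff_mul_single_apply, coeff_schurLift, mul_one,
    N.mul_mem_cancel_right (N.inv_mem hh), mul_inv_rev, inv_inv, map_mul, Matrix.mul_assoc,
    Matrix.trace_mul_comm, Matrix.mul_assoc]

/-- R is defined on all of G and N is normal, so conjugation by g on the group algebra matches
conjugation by R(g) on matrices. Centrality of Φ(1) follows. -/
theorem single_mul_schurLift_comm (hN : N.Normal) (g : G) (T : Matrix (Fin n) (Fin n) A) :
    MonoidAlgebra.single g 1 * schurLift R N w T =
      schurLift R N w (R g * T * R g⁻¹) * MonoidAlgebra.single g 1 := by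
  ext x
  rw [MonoidAlgebra.coeff_single_mul_apply, coeff_schurLift, MonoidAlgebra.coeff_mul_single_apply,
    coeff_schurLift, hN.mem_comm_iff, one_mul, mul_one]
  congr 2
  rw [Matrix.trace_mul_comm (R (x * g⁻¹)⁻¹), Matrix.mul_assoc, ← map_mul,
    Matrix.trace_mul_comm (R g * T), ← Matrix.mul_assoc, ← map_mul]
  simp

theorem groupAlgebraEval_schurLift (hS : SchurRel R N w) (T : Matrix (Fin n) (Fin n) A) :
    groupAlgebraEval R (schurLift R N w T) = T := by
  classical
  ext k l
  have h1 : groupAlgebraEval R (schurLift R N w T) k l =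
      ∑ i, ∑ j, T j i * (w * ∑ g : G, (if g ∈ N then R g⁻¹ i j * R g k l else 0)) := by
    simp only [schurLift, LinearMap.coe_mk, AddHom.coe_mk, map_sum, MonoidAlgebra.lift_single,
      Matrix.sum_apply, Matrix.smul_apply, Finset.mul_sum]
    rw [Finset.sum_congr rfl fun i _ => Finset.sum_comm, Finset.sum_comm]
    refine Finset.sum_congr rfl fun g _ => ?_
    split_ifs
    · simp only [Matrix.trace, Matrix.diag, Matrix.mul_apply, smul_eq_mul, Finset.mul_sum,
        Finset.sum_mul]
      exact Finset.sum_congr rfl fun i _ => Finset.sum_congr rfl fun j _ => by ring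
    · simp
  rw [h1]
  simp [hS _ _ _ _, Matrix.one_apply, Finset.sum_ite_eq, mul_ite]

/-- Φ is linear over A[N] acting from the left. Applied to x = Φ(S), this turns the section property
into multiplicativity of Φ. -/
theorem mul_schurLift_of_support {x : MonoidAlgebra A G} (hx : ∀ g, g ∉ N → x.coeff g = 0)
    (T : Matrix (Fin n) (Fin n) A) :
    x * schurLift R N w T = schurLift R N w (groupAlgebraEval R x * T) := by
  have hx' : x = ∑ g : G, MonoidAlgebra.single g (x.coeff g) := by
    ext y
    classical
    simp [MonoidAlgebra.coeff_sum, MonoidAlgebra.coeff_single]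
  rw [hx']
  simp only [map_sum, Finset.sum_mul]
  refine Finset.sum_congr rfl fun g _ => ?_
  by_cases hg : g ∈ N
  · rw [MonoidAlgebra.lift_single, Matrix.smul_mul, map_smul, ← single_mul_schurLift hg,
      ← smul_mul_assoc, MonoidAlgebra.smul_single, smul_eq_mul, mul_one]
  · simp [hx g hg]

theorem schurLift_mul (hS : SchurRel R N w) (S T : Matrix (Fin n) (Fin n) A) :
    schurLift R N w S * schurLift R N w T = schurLift R N w (S * T) := by
  rw [mul_schurLift_of_support fun g hg => by rw [coeff_schurLift, if_neg hg],
    groupAlgebraEval_schurLift hS]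

theorem schurLift_one_mem_center (hN : N.Normal) :
    schurLift R N w 1 ∈ Subring.center (MonoidAlgebra A G) := by
  rw [Subring.mem_center_iff]
  intro x
  induction x using MonoidAlgebra.induction_linear with
  | zero => simp
  | add x y hx hy => rw [add_mul, hx, hy, mul_add]
  | single g a =>
    have : MonoidAlgebra.single g a = a • (MonoidAlgebra.single g 1 : MonoidAlgebra A G) := by simp
    rw [this, smul_mul_assoc, mul_smul_comm, single_mul_schurLift_comm hN, mul_one, ← map_mul]
    simp

theorem SchurRel.map {B : Type*} [CommRing B] (f : A →+* B) (hS : SchurRel R N w) :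
    SchurRel (mapRep f R) N (f w) := by
  intro i j k l
  have := congrArg f (hS i j k l)
  simpa [map_sum, apply_ite f, Matrix.one_apply] using this

theorem map_schurLift {B : Type*} [CommRing B] (f : A →+* B) (T : Matrix (Fin n) (Fin n) A) :
    MonoidAlgebra.mapRingHom G f (schurLift R N w T) =
      schurLift (mapRep f R) N (f w) (f.mapMatrix T) := by
  ext x
  rw [coeff_schurLift, mapRep_apply, RingHom.mapMatrix_apply, ← Matrix.map_mul]
  simp [coeff_schurLift, apply_ite f, AddMonoidHom.map_trace]

end

/-! ### Endomorphisms of simple modules over a finite field. -/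

-- The eigenvalues in an algebraic closure are m-th roots of unity, and these all come from k.
open Polynomial in
theorem trace_mem_range_of_pow_eq_one {k F V : Type*} [Field k] [Field F] [Algebra k F]
    [AddCommGroup V] [Module F V] [FiniteDimensional F V] {m : ℕ} (hm : m ≠ 0)
    (hs : (X ^ m - 1 : k[X]).Splits) {f : Module.End F V} (hf : f ^ m = 1) :
    LinearMap.trace F V f ∈ (algebraMap k F).fieldRange := by
  classical
  let b := Module.finBasis F V
  let A := LinearMap.toMatrix b b f
  let E := AlgebraicClosure F
  let A' : Matrix _ _ E := A.map (algebraMap F E)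
  have hA : A ^ m = 1 := by
    have : A = LinearMap.toMatrixAlgEquiv b f := rfl
    rw [this, ← map_pow, hf, map_one]
  have hA' : A' ^ m = 1 := by
    have := congrArg (algebraMap F E).mapMatrix hA
    rwa [map_pow, map_one] at this
  have hroot : ∀ μ : E, μ ^ m = 1 → μ ∈ (algebraMap k E).fieldRange := by
    intro μ hμ
    have hp : (X ^ m - 1 : k[X]) ≠ 0 := X_pow_sub_C_ne_zero (Nat.pos_of_ne_zero hm) 1
    exact hs.mem_range_of_isRoot hp (i := algebraMap k E) (x := μ) (by simp [hμ])
  have htr : A'.trace ∈ (algebraMap k E).fieldRange := by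
    rw [Matrix.trace_eq_sum_roots_charpoly]
    refine multiset_sum_mem _ fun μ hμ => hroot μ ?_
    have hμ' := Polynomial.isRoot_of_mem_roots hμ
    rw [← Matrix.mem_spectrum_iff_isRoot_charpoly] at hμ'
    have h1 := spectrum.pow_mem_pow A' m hμ'
    rw [hA'] at h1
    have : Nontrivial (Matrix (Fin (Module.finrank F V)) (Fin (Module.finrank F V)) E) := by
      by_contra h
      rw [not_nontrivial_iff_subsingleton] at h
      simp at hμ'
    rwa [spectrum.one_eq, Set.mem_singleton_iff] at h1
  rw [LinearMap.trace_eq_matrix_trace F b]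
  obtain ⟨c, hc⟩ := htr
  refine ⟨c, (algebraMap F E).injective ?_⟩
  rw [← IsScalarTower.algebraMap_apply, hc]
  exact (AddMonoidHom.map_trace (algebraMap F E) A).symm

-- Rank-one endomorphisms attain every trace d in F. If every endomorphism is a k-combination of
-- group elements, whose traces lie in k, then d lies in k.
open Polynomial in
theorem algebraMap_surjective_of_forall_exists_sum {k F V N : Type*} [Field k] [Field F]
    [Algebra k F] [AddCommGroup V] [Module F V] [FiniteDimensional F V] [Nontrivial V]
    [Group N] [Fintype N] (τ : N →* Module.End F V) {m : ℕ} (hm : m ≠ 0)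
    (hs : (X ^ m - 1 : k[X]).Splits) (hτ : ∀ g, τ g ^ m = 1)
    (hspan : ∀ T : Module.End F V, ∃ c : N → k, T = ∑ g, algebraMap k F (c g) • τ g) :
    Function.Surjective (algebraMap k F) := by
  intro d
  obtain ⟨v, hv⟩ := exists_ne (0 : V)
  obtain ⟨f, hf⟩ := Module.Projective.exists_dual_eq_one F hv
  obtain ⟨c, hc⟩ := hspan (d • f.smulRight v)
  have h1 : LinearMap.trace F V (d • f.smulRight v) = d := by
    rw [map_smul, LinearMap.trace_smulRight, hf, smul_eq_mul, mul_one]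
  have h2 : LinearMap.trace F V (d • f.smulRight v) ∈ (algebraMap k F).fieldRange := by
    rw [hc, map_sum]
    refine sum_mem fun g _ => ?_
    rw [map_smul]
    exact mul_mem ⟨c g, rfl⟩ (trace_mem_range_of_pow_eq_one hm hs (hτ g))
  rw [h1] at h2
  exact h2

-- The endomorphism ring D is a finite division ring, hence a field by Wedderburn. Jacobson density
-- writes every D-linear endomorphism as a k-combination of group elements, and the trace argument
-- then forces D = k.
open Polynomial in
theorem exists_eq_smul_of_isSimpleModule {k N V : Type*} [Field k] [Finite k] [Group N] [Finite N]
    [AddCommGroup V] [Module k V] [FiniteDimensional k V] (τ : Representation k N V)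
    [IsSimpleModule (MonoidAlgebra k N) τ.asModule]
    (hs : (X ^ Nat.card N - 1 : k[X]).Splits)
    (f : Module.End (MonoidAlgebra k N) τ.asModule) : ∃ c : k, ∀ v : τ.asModule, f v = c • v := by
  classical
  have : Fintype N := Fintype.ofFinite N
  have : Finite V := Module.finite_of_finite k
  have : Finite τ.asModule := this
  have : Finite (Module.End (MonoidAlgebra k N) τ.asModule) :=
    Finite.of_injective (fun f => (f : τ.asModule → τ.asModule)) DFunLike.coe_injective
  have : Nontrivial τ.asModule := IsSimpleModule.nontrivial (MonoidAlgebra k N) _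
  let D := Module.End (MonoidAlgebra k N) τ.asModule
  let τ' : N →* Module.End D τ.asModule :=
    ((Module.toModuleEnd D (S := MonoidAlgebra k N) τ.asModule : MonoidAlgebra k N →+* _) :
      MonoidAlgebra k N →* _).comp (MonoidAlgebra.of k N)
  have hfin : Module.Finite D τ.asModule := by
    infer_instance
  have key := @algebraMap_surjective_of_forall_exists_sum k D τ.asModule N _ (littleWedderburn D)
    (inferInstanceAs (Algebra k D)) _ _ hfin _ _ _ τ' (Nat.card N) Nat.card_pos.ne' hs
    (fun g => by rw [← map_pow, pow_card_eq_one', map_one]) (fun T => by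
      have : Fintype τ.asModule := Fintype.ofFinite _
      obtain ⟨r, hr⟩ := jacobson_density (R := MonoidAlgebra k N) T Finset.univ
      refine ⟨fun g => r.coeff g, LinearMap.ext fun v => ?_⟩
      rw [hr v (Finset.mem_univ v)]
      have hr' : r = ∑ g : N, MonoidAlgebra.single g (r.coeff g) := by
        ext y
        simp [MonoidAlgebra.coeff_sum, MonoidAlgebra.coeff_single]
      have h2 : ∀ g, MonoidAlgebra.single g (r.coeff g) • v =
          r.coeff g • ((MonoidAlgebra.single g 1 : MonoidAlgebra k N) • v) := fun g => by
        rw [← smul_assoc, MonoidAlgebra.smul_single, smul_eq_mul, mul_one]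
      conv_lhs => rw [hr', Finset.sum_smul, Finset.sum_congr rfl fun g _ => h2 g]
      exact (map_sum (AddMonoidHom.mk' (fun T : Module.End D τ.asModule => T v) fun _ _ => rfl)
        (fun g => (algebraMap k D (r.coeff g)) • τ' g) Finset.univ).symm)
  obtain ⟨c, hc⟩ := key f
  refine ⟨c, fun v => ?_⟩
  rw [← hc]
  rfl

theorem single_one_smul_asModule {A G V : Type*} [CommRing A] [Group G] [AddCommGroup V]
    [Module A V] (ρ : Representation A G V) (g : G) (v : ρ.asModule) :
    (MonoidAlgebra.single g 1 : MonoidAlgebra A G) • v =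
      ρ.asModuleEquiv.symm (ρ g (ρ.asModuleEquiv v)) := by
  rw [Representation.single_smul, one_smul]
  rfl

theorem map_asModule {A G V W : Type*} [CommRing A] [Group G] [AddCommGroup V] [Module A V]
    [AddCommGroup W] [Module A W] {ρ : Representation A G V} {σ : Representation A G W}
    (f : ρ.asModule →ₗ[MonoidAlgebra A G] σ.asModule) (g : G) (v : V) :
    f (ρ.asModuleEquiv.symm (ρ g v)) = σ.asModuleEquiv.symm (σ g (σ.asModuleEquiv
      (f (ρ.asModuleEquiv.symm v)))) := by
  have h := f.map_smul (MonoidAlgebra.single g 1) (ρ.asModuleEquiv.symm v)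
  rwa [single_one_smul_asModule, single_one_smul_asModule, LinearEquiv.apply_symm_apply] at h

/-! ### Passing from the residue field to O and to K. -/

section

open IsLocalRing

variable {O N : Type*} [CommRing O] [IsLocalRing O] [Group N] {n : ℕ}

theorem map_residue_eq_zero_iff (T : Matrix (Fin n) (Fin n) O) :
    T.map (residue O) = 0 ↔ ∀ i j, T i j ∈ maximalIdeal O := by
  simp [← Matrix.ext_iff, residue_eq_zero_iff]

/-- Matrices over the residue field that commute with a group of order invertible in `O` lift. -/
theorem exists_commute_lift [Fintype N] (R : N →* Matrix (Fin n) (Fin n) O)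
    (hN : IsUnit (Fintype.card N : O)) {T : Matrix (Fin n) (Fin n) (ResidueField O)}
    (hT : ∀ g, mapRep (residue O) R g * T = T * mapRep (residue O) R g) :
    ∃ S : Matrix (Fin n) (Fin n) O, S.map (residue O) = T ∧ ∀ g, R g * S = S * R g := by
  obtain ⟨S₀, hS₀⟩ : ∃ S₀ : Matrix (Fin n) (Fin n) O, S₀.map (residue O) = T :=
    ⟨T.map (Function.surjInv residue_surjective), by
      ext i j; simp [Function.surjInv_eq residue_surjective]⟩
  obtain ⟨u, hu⟩ := hN
  refine ⟨(↑u⁻¹ : O) • ∑ h, R h * S₀ * R h⁻¹, ?_, fun g => ?_⟩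
  · have h1 : ∀ h, (R h * S₀ * R h⁻¹).map (residue O) = T := fun h => by
      rw [Matrix.map_mul, Matrix.map_mul, hS₀, ← mapRep_apply, ← mapRep_apply, hT, Matrix.mul_assoc,
        ← map_mul, mul_inv_cancel, map_one, mul_one]
    change (residue O).mapMatrix _ = T
    rw [Algebra.smul_def, map_mul, map_sum]
    simp only [RingHom.mapMatrix_apply, h1]
    rw [Finset.sum_const, Finset.card_univ, ← Nat.cast_smul_eq_nsmul (ResidueField O),
      ← map_natCast (residue O), ← hu]
    ext i j
    simp [Matrix.algebraMap_eq_diagonal, Matrix.diagonal_mul]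
  · rw [mul_smul_comm, smul_mul_assoc, Finset.mul_sum, Finset.sum_mul]
    congr 1
    refine Fintype.sum_equiv (Equiv.mulLeft g) _ _ fun h => ?_
    rw [Equiv.coe_mulLeft, mul_inv_rev, map_mul, map_mul, mul_assoc, mul_assoc _ _ (R g),
      mul_assoc _ _ (R g), ← map_mul R g⁻¹ g, inv_mul_cancel, map_one, mul_one]
    simp only [mul_assoc]

/-- The lifts that commute with R form a nonempty compact subsemigroup of M_n(O), and a compact
semigroup contains an idempotent. -/
theorem exists_isIdempotentElem_lift [TopologicalSpace O] [IsTopologicalRing O] [CompactSpace O]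
    [T2Space O] (hcl : IsClosed (maximalIdeal O : Set O)) (R : N →* Matrix (Fin n) (Fin n) O)
    {S : Matrix (Fin n) (Fin n) O} (hS : ∀ g, R g * S = S * R g)
    (hS2 : IsIdempotentElem (S.map (residue O))) :
    ∃ e : Matrix (Fin n) (Fin n) O, IsIdempotentElem e ∧ (∀ g, R g * e = e * R g) ∧
      e.map (residue O) = S.map (residue O) := by
  have : CompactSpace (Matrix (Fin n) (Fin n) O) :=
    inferInstanceAs (CompactSpace (Fin n → Fin n → O))
  let s : Set (Matrix (Fin n) (Fin n) O) :=
    {e | (∀ g, R g * e = e * R g) ∧ ∀ i j, e i j - S i j ∈ (maximalIdeal O : Set O)}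
  have hs : ∀ e : Matrix (Fin n) (Fin n) O, (∀ i j, e i j - S i j ∈ (maximalIdeal O : Set O)) ↔
      e.map (residue O) = S.map (residue O) := fun e => by
    rw [← sub_eq_zero, ← Matrix.map_sub _ (map_sub _), map_residue_eq_zero_iff]; rfl
  obtain ⟨e, he, hee⟩ := exists_idempotent_in_compact_subsemigroup
    (M := Matrix (Fin n) (Fin n) O) (fun r => by fun_prop) s ⟨S, hS, by simp⟩
    (IsClosed.isCompact (by
      have h1 : s = (⋂ g, {e | R g * e = e * R g}) ∩
          ⋂ i, ⋂ j, (fun e : Matrix (Fin n) (Fin n) O => e i j - S i j) ⁻¹' maximalIdeal O := by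
        ext e; simp [s]
      rw [h1]
      exact (isClosed_iInter fun g => isClosed_eq (by fun_prop) (by fun_prop)).inter
        (isClosed_iInter fun i => isClosed_iInter fun j => hcl.preimage (by fun_prop))))
    (by
      rintro x ⟨hx, hx'⟩ y ⟨hy, hy'⟩
      refine ⟨fun g => by rw [← mul_assoc, hx, mul_assoc, hy, mul_assoc], ?_⟩
      rw [hs] at hx' hy' ⊢
      rw [Matrix.map_mul, hx', hy', hS2])
  exact ⟨e, hee, he.1, (hs e).1 he.2⟩

/-- The representation on column vectors attached to a matrix representation. -/
def colRep {A : Type*} [CommRing A] (R : N →* Matrix (Fin n) (Fin n) A) :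
    Representation A N (Fin n → A) :=
  ((Matrix.toLinAlgEquiv' : Matrix (Fin n) (Fin n) A ≃ₐ[A] Module.End A (Fin n → A)) :
    Matrix (Fin n) (Fin n) A →* Module.End A (Fin n → A)).comp R

/-- By Maschke a submodule is the image of an equivariant projection. The projection lifts to an
idempotent over O commuting with R, which has to be 0 or 1. -/
theorem colRep_isSimpleModule [Fintype N] [TopologicalSpace O] [IsTopologicalRing O] [CompactSpace
    O]
    [T2Space O] (hcl : IsClosed (maximalIdeal O : Set O)) (hn : n ≠ 0)
    (R : N →* Matrix (Fin n) (Fin n) O) (hN : IsUnit (Fintype.card N : O))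
    (hR : ∀ e : Matrix (Fin n) (Fin n) O, IsIdempotentElem e → (∀ g, R g * e = e * R g) →
      e = 0 ∨ e = 1) :
    IsSimpleModule (MonoidAlgebra (ResidueField O) N)
      (colRep (mapRep (residue O) R)).asModule := by
  let τ := colRep (mapRep (residue O) R)
  have : NeZero (Nat.card N : ResidueField O) := ⟨by
    rw [Nat.card_eq_fintype_card, ← map_natCast (residue O)]
    exact (hN.map (residue O)).ne_zero⟩
  have : Nontrivial τ.asModule := by
    have : Nonempty (Fin n) := ⟨⟨0, Nat.pos_of_ne_zero hn⟩⟩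
    exact inferInstanceAs (Nontrivial (Fin n → ResidueField O))
  refine { eq_bot_or_eq_top := fun p => ?_ }
  obtain ⟨q, hpq⟩ := MonoidAlgebra.Submodule.exists_isCompl p
  let f : τ.asModule →ₗ[MonoidAlgebra (ResidueField O) N] τ.asModule := p.projection q hpq
  let f' : (Fin n → ResidueField O) →ₗ[ResidueField O] (Fin n → ResidueField O) :=
    f.restrictScalars (ResidueField O)
  let T := LinearMap.toMatrix' f'
  have hfT : ∀ v, f v = T.mulVec v := fun v => (LinearMap.toMatrix'_mulVec f' v).symm
  have hTT : IsIdempotentElem T := by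
    change T * T = T
    rw [← LinearMap.toMatrix'_mul]
    congr 1
    exact LinearMap.ext fun v => LinearMap.congr_fun (p.isIdempotentElem_projection hpq).eq v
  have hT : ∀ g, mapRep (residue O) R g * T = T * mapRep (residue O) R g := by
    intro g
    refine Matrix.toLin'.injective (LinearMap.ext fun v => ?_)
    rw [Matrix.toLin'_mul, Matrix.toLin'_mul, LinearMap.comp_apply, LinearMap.comp_apply,
      Matrix.toLin'_toMatrix']
    exact (map_asModule f g v).symm
  obtain ⟨S, hST, hS⟩ := exists_commute_lift R hN hT
  rw [← hST] at hTT
  obtain ⟨e, he, heR, heS⟩ := exists_isIdempotentElem_lift hcl R hS hTT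
  rw [hST] at heS
  rw [← p.range_projection hpq]
  rcases hR e he heR with rfl | rfl
  · left
    rw [LinearMap.range_eq_bot]
    ext1 v
    change f v = 0
    rw [hfT, ← heS, Matrix.map_zero _ (map_zero _)]
    exact Matrix.zero_mulVec v
  · right
    rw [LinearMap.range_eq_top]
    intro v
    refine ⟨v, ?_⟩
    change f v = v
    rw [hfT, ← heS, Matrix.map_one _ (map_zero _) (map_one _)]
    exact Matrix.one_mulVec v

-- Nakayama for the commutant E of R: modulo ϖ an element of E is scalar, so it is a scalar plus ϖD.
-- Since ϖ can be cancelled, D lies in E again, and E ≤ O·1 + ϖE.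
set_option linter.overlappingInstances false in
open Polynomial in
theorem exists_eq_smul_one_of_commute [Fintype N] [IsDomain O] [IsDiscreteValuationRing O]
    [TopologicalSpace O] [IsTopologicalRing O] [CompactSpace O]
    [T2Space O] (hcl : IsClosed (maximalIdeal O : Set O)) [Finite (ResidueField O)] (hn : n ≠ 0)
    (R : N →* Matrix (Fin n) (Fin n) O) (hN : IsUnit (Fintype.card N : O))
    (hs : (X ^ Nat.card N - 1 : (ResidueField O)[X]).Splits)
    (hR : ∀ e : Matrix (Fin n) (Fin n) O, IsIdempotentElem e → (∀ g, R g * e = e * R g) →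
      e = 0 ∨ e = 1) {S : Matrix (Fin n) (Fin n) O} (hS : ∀ g, R g * S = S * R g) :
    ∃ c : O, S = c • 1 := by
  have hsimp := colRep_isSimpleModule hcl hn R hN hR
  let E : Submodule O (Matrix (Fin n) (Fin n) O) :=
    { carrier := {S | ∀ g, R g * S = S * R g}
      zero_mem' := by simp
      add_mem' := fun ha hb g => by rw [mul_add, add_mul, ha, hb]
      smul_mem' := fun c x hx g => by rw [mul_smul_comm, smul_mul_assoc, hx] }
  obtain ⟨ϖ, hϖ⟩ := IsDiscreteValuationRing.exists_irreducible O
  have key : E ≤ Submodule.span O {1} := by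
    refine Submodule.le_of_le_smul_of_le_jacobson_bot (I := maximalIdeal O)
      (IsNoetherian.noetherian E) (IsLocalRing.jacobson_eq_maximalIdeal ⊥ bot_ne_top).ge ?_
    intro T hT
    obtain ⟨c, hc⟩ := exists_eq_smul_of_isSimpleModule (colRep (mapRep (residue O) R)) hs
      (Representation.IntertwiningMap.equivLinearMapAsModule _ _
        ⟨(T.map (residue O)).mulVecLin, fun g => by
          refine LinearMap.ext fun v => ?_
          change (T.map (residue O)).mulVec ((mapRep (residue O) R g).mulVec v) =
            (mapRep (residue O) R g).mulVec ((T.map (residue O)).mulVec v)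
          rw [Matrix.mulVec_mulVec, Matrix.mulVec_mulVec, mapRep_apply, ← Matrix.map_mul,
            ← Matrix.map_mul, hT g]⟩)
    obtain ⟨c, rfl⟩ := residue_surjective c
    have h1 : (T - c • 1).map (residue O) = 0 := by
      refine Matrix.toLin'.injective (LinearMap.ext fun v => ?_)
      have h0 : (T.map (residue O)).mulVec v = residue O c • v := hc v
      rw [Matrix.map_sub _ (map_sub _), map_sub, LinearMap.sub_apply, Matrix.toLin'_apply, h0]
      have : (c • (1 : Matrix (Fin n) (Fin n) O)).map (residue O) = residue O c • 1 := by
        ext i j; simp [Matrix.one_apply, apply_ite (residue O)]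
      rw [this]
      simp
    rw [map_residue_eq_zero_iff] at h1
    have h2 : ∀ i j, ∃ d, (T - c • 1) i j = ϖ * d := fun i j => by
      have := h1 i j
      rwa [hϖ.maximalIdeal_eq, Ideal.mem_span_singleton] at this
    choose D hD using h2
    have h3 : T - c • 1 = ϖ • Matrix.of D := by
      ext i j; simp [← hD]
    have h4 : Matrix.of D ∈ E := by
      intro g
      have : ϖ • (R g * Matrix.of D) = ϖ • (Matrix.of D * R g) := by
        rw [← mul_smul_comm, ← smul_mul_assoc, ← h3, mul_sub, sub_mul, hT g]
        simp
      exact smul_right_injective _ hϖ.ne_zero this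
    rw [show T = c • 1 + ϖ • Matrix.of D by rw [← h3]; abel]
    exact Submodule.add_mem_sup (Submodule.smul_mem _ _ (Submodule.mem_span_singleton_self _))
      (Submodule.smul_mem_smul (hϖ.maximalIdeal_eq ▸ Ideal.mem_span_singleton_self ϖ) h4)
  obtain ⟨c, hc⟩ := Submodule.mem_span_singleton.1 (key hS)
  exact ⟨c, hc.symm⟩

theorem exists_eq_smul_one_of_commute_map {K : Type*} [Field K] [Algebra O K] [IsFractionRing O K]
    {R : N →* Matrix (Fin n) (Fin n) O}
    (hR : ∀ S : Matrix (Fin n) (Fin n) O, (∀ g, R g * S = S * R g) → ∃ c : O, S = c • 1)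
    {T : Matrix (Fin n) (Fin n) K}
    (hT : ∀ g, mapRep (algebraMap O K) R g * T = T * mapRep (algebraMap O K) R g) :
    ∃ c : K, T = c • 1 := by
  obtain ⟨b, hb⟩ := IsLocalization.exist_integer_multiples_of_finite (nonZeroDivisors O)
    (fun ij : Fin n × Fin n => T ij.1 ij.2)
  choose S hS using hb
  have hST : (Matrix.of fun i j => S (i, j)).map (algebraMap O K) = (b : O) • T := by
    ext i j; simp [hS]
  obtain ⟨c, hc⟩ := hR (Matrix.of fun i j => S (i, j)) fun g => by
    apply Matrix.map_injective (IsFractionRing.injective O K)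
    change Matrix.map _ _ = Matrix.map _ _
    rw [Matrix.map_mul, Matrix.map_mul, hST, ← mapRep_apply, mul_smul_comm, smul_mul_assoc, hT]
  have hb0 : algebraMap O K b ≠ 0 := IsFractionRing.to_map_ne_zero_of_mem_nonZeroDivisors b.2
  refine ⟨(algebraMap O K b)⁻¹ * algebraMap O K c, ?_⟩
  rw [hc, ← algebraMap_smul K (b : O) T, ← inv_smul_eq_iff₀ hb0] at hST
  rw [← hST, mul_smul]
  congr 1
  ext i j
  simp [Matrix.one_apply, apply_ite (algebraMap O K)]

end

/-- Averaging a matrix unit over N gives a scalar c, whose trace yields n c = |N| δ. With the weight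
n/|N| this is enough, and n is never inverted. -/
theorem schurRel_of_commute {K G : Type*} [Field K] [CharZero K] [Group G] [Fintype G] {n : ℕ}
    {R : G →* Matrix (Fin n) (Fin n) K} {N : Subgroup G}
    (hC : ∀ T, (∀ g ∈ N, R g * T = T * R g) → ∃ c : K, T = c • 1) :
    SchurRel R N (n / Nat.card N) := by
  classical
  intro i j k l
  let T : Matrix (Fin n) (Fin n) K := ∑ g : N, R (g : G)⁻¹ * Matrix.single j k 1 * R g
  have hN0 : (Nat.card N : K) ≠ 0 := by exact_mod_cast Nat.card_pos.ne'
  obtain ⟨c, hc⟩ := hC T (fun h hh => by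
    rw [Finset.mul_sum, Finset.sum_mul]
    refine Fintype.sum_equiv (Equiv.mulRight (⟨h, hh⟩⁻¹ : N)) _ _ fun g => ?_
    have h1 : R h * R (g : G)⁻¹ = R (h * (g : G)⁻¹) := (map_mul _ _ _).symm
    have h2 : R g = R (g * h⁻¹) * R h := by rw [← map_mul, inv_mul_cancel_right]
    rw [← mul_assoc, ← mul_assoc, h1]
    conv_lhs => rw [h2, ← mul_assoc]
    simp)
  have htr : (n : K) * c = Nat.card N * (1 : Matrix (Fin n) (Fin n) K) k j := by
    have h1 : T.trace = c * n := by rw [hc]; simp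
    have h2 : T.trace = Nat.card N * (1 : Matrix (Fin n) (Fin n) K) k j := by
      rw [Matrix.trace_sum]
      have : ∀ g : N, (R (g : G)⁻¹ * Matrix.single j k 1 * R g).trace =
          (1 : Matrix (Fin n) (Fin n) K) k j := fun g => by
        rw [Matrix.trace_mul_cycle, ← map_mul, mul_inv_cancel, map_one, one_mul]
        by_cases h : j = k
        · subst h; simp
        · rw [Matrix.trace_single_eq_of_ne _ _ _ h, Matrix.one_apply_ne (Ne.symm h)]
      simp [this]
    rw [mul_comm, ← h1, h2]
  have hent : T i l = ∑ g : G, (if g ∈ N then R g⁻¹ i j * R g k l else 0) := by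
    rw [show T i l = ∑ g : N,
      (R (g : G)⁻¹ * Matrix.single j k 1 * R g : Matrix (Fin n) (Fin n) K) i l from
          Matrix.sum_apply _ _ _ _, ← Finset.sum_filter]
    rw [Finset.sum_subtype (p := (· ∈ N)) (Finset.univ.filter (· ∈ N)) (by simp)]
    refine Finset.sum_congr rfl fun g _ => ?_
    simp [Matrix.mul_apply, Matrix.single_apply, Finset.sum_ite_eq, ite_and, mul_ite, ite_mul]
  rw [← hent, hc, Matrix.smul_apply, smul_eq_mul, ← mul_assoc, div_mul_eq_mul_div, htr,
    mul_div_cancel_left₀ _ hN0]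

theorem SchurRel.of_map {A B G : Type*} [CommRing A] [CommRing B] [Group G] [Fintype G] {n : ℕ}
    {R : G →* Matrix (Fin n) (Fin n) A} {N : Subgroup G} {w : A} (f : A →+* B)
    (hf : Function.Injective f) (h : SchurRel (mapRep f R) N (f w)) : SchurRel R N w := by
  intro i j k l
  apply hf
  have := h i j k l
  simpa [map_sum, apply_ite f, Matrix.one_apply] using this

/-! ### Twist elements: the action of G ⧸ N on the Φ(1)-component. -/

section

variable {A G : Type*} [CommRing A] [Group G] [Fintype G] {n : ℕ}
  {R : G →* Matrix (Fin n) (Fin n) A} {N : Subgroup G} {w : A}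

variable (R N w) in
/-- The element `g Φ(R(g)⁻¹)`, which commutes with all `Φ(T)`, where `Φ` is `schurLift`. -/
def twistElement (g : G) : MonoidAlgebra A G :=
  MonoidAlgebra.single g 1 * schurLift R N w (R g⁻¹)

theorem schurLift_mul_single_comm (hN : N.Normal) (g : G) (T : Matrix (Fin n) (Fin n) A) :
    schurLift R N w T * MonoidAlgebra.single g 1 =
      MonoidAlgebra.single g 1 * schurLift R N w (R g⁻¹ * T * R g) := by
  rw [single_mul_schurLift_comm hN]
  simp only [← mul_assoc, ← map_mul, mul_inv_cancel, map_one, one_mul]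
  rw [mul_assoc, ← map_mul]
  simp

theorem twistElement_mul_schurLift (hS : SchurRel R N w) (g : G) (T : Matrix (Fin n) (Fin n) A) :
    twistElement R N w g * schurLift R N w T =
      MonoidAlgebra.single g 1 * schurLift R N w (R g⁻¹ * T) := by
  rw [twistElement, mul_assoc, schurLift_mul hS]

/-- Moving Φ(T) past g conjugates T by R(g), and the factor R(g)⁻¹ undoes this. -/
theorem twistElement_comm_schurLift (hN : N.Normal) (hS : SchurRel R N w) (g : G)
    (T : Matrix (Fin n) (Fin n) A) :
    twistElement R N w g * schurLift R N w T = schurLift R N w T * twistElement R N w g := by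
  rw [twistElement_mul_schurLift hS, twistElement, ← mul_assoc, schurLift_mul_single_comm hN,
    mul_assoc, schurLift_mul hS, mul_assoc _ (R g), ← map_mul]
  simp

theorem twistElement_mul (hN : N.Normal) (hS : SchurRel R N w) (g h : G) :
    twistElement R N w g * twistElement R N w h = twistElement R N w (g * h) := by
  rw [twistElement, twistElement, mul_assoc, ← mul_assoc (schurLift R N w _),
    schurLift_mul_single_comm hN, mul_assoc, schurLift_mul hS, mul_assoc _ (R h), ← map_mul R h,
    mul_inv_cancel, map_one, mul_one, ← mul_assoc, MonoidAlgebra.single_mul_single, mul_one,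
    ← map_mul, ← mul_inv_rev, twistElement]

theorem twistElement_of_mem {g : G} (hg : g ∈ N) :
    twistElement R N w g = schurLift R N w 1 := by
  rw [twistElement, single_mul_schurLift hg, ← map_mul, mul_inv_cancel, map_one]

theorem twistElement_mul_comm (hN : N.Normal) (hS : SchurRel R N w)
    (hab : ∀ g h : G, (h * g)⁻¹ * (g * h) ∈ N) (g h : G) :
    twistElement R N w g * twistElement R N w h = twistElement R N w h * twistElement R N w g := by
  have h1 : g * h = h * g * ((h * g)⁻¹ * (g * h)) := by group
  rw [twistElement_mul hN hS, twistElement_mul hN hS, h1, ← twistElement_mul hN hS,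
    twistElement_of_mem (hab g h), twistElement_mul_schurLift hS, mul_one, twistElement]

/-- On the Φ(1)-component, g factors into the twist element, which sees only G ⧸ N, and the matrix
R(g). -/
theorem single_mul_schurLift_eq (hS : SchurRel R N w) (g : G) (T : Matrix (Fin n) (Fin n) A) :
    MonoidAlgebra.single g 1 * schurLift R N w T =
      twistElement R N w g * schurLift R N w (R g * T) := by
  rw [twistElement_mul_schurLift hS, ← mul_assoc, ← map_mul]
  simp

variable {M : Type*} [AddCommGroup M] [Module A M] [Module (MonoidAlgebra A G) M]
  [IsScalarTower A (MonoidAlgebra A G) M]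

variable (R N w) in
/-- The linear map `v ↦ Φ(v ⊗ f) m`, where `Φ` is `schurLift`. -/
def orbitMap (f : Fin n → A) (m : M) : (Fin n → A) →ₗ[A] M where
  toFun v := schurLift R N w (Matrix.vecMulVec v f) • m
  map_add' u v := by rw [Matrix.add_vecMulVec, map_add, add_smul]
  map_smul' a v := by rw [Matrix.smul_vecMulVec, map_smul, smul_assoc, RingHom.id_apply]

theorem orbitMap_apply (f : Fin n → A) (m : M) (v : Fin n → A) :
    orbitMap R N w f m v = schurLift R N w (Matrix.vecMulVec v f) • m := rfl

theorem schurLift_smul_orbitMap (hS : SchurRel R N w) (f : Fin n → A) (m : M)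
    (T : Matrix (Fin n) (Fin n) A) (v : Fin n → A) :
    schurLift R N w T • orbitMap R N w f m v = orbitMap R N w f m (T.mulVec v) := by
  rw [orbitMap_apply, orbitMap_apply, ← mul_smul, schurLift_mul hS, Matrix.mul_vecMulVec]

theorem single_smul_orbitMap {g : G} (hg : g ∈ N) (f : Fin n → A) (m : M) (v : Fin n → A) :
    (MonoidAlgebra.single g 1 : MonoidAlgebra A G) • orbitMap R N w f m v =
      orbitMap R N w f m ((R g).mulVec v) := by
  rw [orbitMap_apply, orbitMap_apply, ← mul_smul, single_mul_schurLift hg, Matrix.mul_vecMulVec]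

end

-- D is a domain, so the minimal polynomial of d is irreducible. It divides a split polynomial,
-- hence is linear.
open Polynomial in
theorem exists_algebraMap_eq_of_pow_eq_one {K D : Type*} [Field K] [Ring D] [IsDomain D]
    [Algebra K D] {m : ℕ} (hm : m ≠ 0) (hs : (X ^ m - 1 : K[X]).Splits) {d : D} (hd : d ^ m = 1) :
    ∃ c : K, algebraMap K D c = d := by
  have hmon : (X ^ m - 1 : K[X]).Monic := monic_X_pow_sub_C 1 hm
  have hint : IsIntegral K d := ⟨X ^ m - 1, hmon, by simp [hd]⟩
  have hdvd : minpoly K d ∣ X ^ m - 1 := minpoly.dvd K d (by simp [hd])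
  have h1 := (hs.of_dvd hmon.ne_zero hdvd).degree_eq_one_of_irreducible (minpoly.irreducible hint)
  exact minpoly.mem_range_of_degree_eq_one K d h1

open Polynomial in
/-- A simple module on which the idempotent `Φ(1)` acts as the identity is a twist of `R` by a
character of `G ⧸ N`. -/
theorem exists_twist_of_isSimpleModule {K G : Type*} [Field K] [Group G] [Fintype G] {n : ℕ}
    {R : G →* Matrix (Fin n) (Fin n) K} {N : Subgroup G} {w : K} (hN : N.Normal)
    (hS : SchurRel R N w) (hab : ∀ g h : G, (h * g)⁻¹ * (g * h) ∈ N)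
    (hs : (X ^ Fintype.card G - 1 : K[X]).Splits)
    {S : Type*} [AddCommGroup S] [Module K S] [Module (MonoidAlgebra K G) S]
    [IsScalarTower K (MonoidAlgebra K G) S] [IsSimpleModule (MonoidAlgebra K G) S]
    (he : ∀ s : S, schurLift R N w 1 • s = s) :
    ∃ χ : G →* Kˣ, (∀ h ∈ N, χ h = 1) ∧ ∃ φ : (Fin n → K) →ₗ[K] S, Function.Bijective φ ∧
      ∀ g v, (MonoidAlgebra.single g 1 : MonoidAlgebra K G) • φ v =
        (χ g : K) • φ ((R g).mulVec v) := by
  classical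
  have : Nontrivial S := IsSimpleModule.nontrivial (MonoidAlgebra K G) S
  -- Twist elements commute with Φ and, G ⧸ N being abelian, with each other. As Φ(1) is the
  -- identity on S, they commute with G there and define endomorphisms of S.
  have hcomm : ∀ g h (s : S), twistElement R N w g • (MonoidAlgebra.single h 1 : MonoidAlgebra K G)
      • s = (MonoidAlgebra.single h 1 : MonoidAlgebra K G) • twistElement R N w g • s := by
    intro g h s
    conv_lhs => rw [← he s, ← mul_smul (MonoidAlgebra.single h 1), single_mul_schurLift_eq hS,
      mul_one, ← mul_smul, ← mul_assoc, twistElement_mul_comm hN hS hab, mul_assoc,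
      twistElement_comm_schurLift hN hS, ← mul_assoc]
    conv_rhs => rw [← he (twistElement R N w g • s), ← mul_smul (MonoidAlgebra.single h 1),
      single_mul_schurLift_eq hS, mul_one, ← mul_smul]
  let U : G →* Module.End (MonoidAlgebra K G) S :=
    { toFun := fun g =>
        { toFun := fun s => twistElement R N w g • s
          map_add' := smul_add _
          map_smul' := fun x s => by
            rw [RingHom.id_apply]
            induction x using MonoidAlgebra.induction_linear with
            | zero => simp
            | add x y hx hy => rw [add_smul, smul_add, hx, hy, add_smul]
            | single h a =>
              rw [← mul_one a, ← smul_eq_mul, ← MonoidAlgebra.smul_single, smul_assoc, smul_assoc,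
                ← hcomm, smul_algebra_smul_comm] }
      map_one' := by
        ext s
        change twistElement R N w 1 • s = s
        rw [twistElement_of_mem N.one_mem, he]
      map_mul' := fun g h => by
        ext s
        change twistElement R N w (g * h) • s = twistElement R N w g • twistElement R N w h • s
        rw [← twistElement_mul hN hS, mul_smul] }
  have hU : ∀ g, ∃ c : K, ∀ s : S, twistElement R N w g • s = c • s := by
    intro g
    -- By Schur's lemma the endomorphism ring is a division ring, and `U g` has finite order in it.
    obtain ⟨c, hc⟩ := exists_algebraMap_eq_of_pow_eq_one (D := Module.End (MonoidAlgebra K G) S)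
      Fintype.card_ne_zero hs (d := U g) (by rw [← map_pow, pow_card_eq_one, map_one])
    exact ⟨c, fun s => (LinearMap.congr_fun hc s).symm⟩
  choose c hc using hU
  have hinj : ∀ a b : K, (∀ s : S, a • s = b • s) → a = b := fun a b h => by
    obtain ⟨s, hs⟩ := exists_ne (0 : S)
    exact smul_left_injective K hs (h s)
  let χ₀ : G →* K :=
    { toFun := c
      map_one' := hinj _ _ fun s => by rw [← hc, twistElement_of_mem N.one_mem, he, one_smul]
      map_mul' := fun g h => hinj _ _ fun s => by
        rw [← hc, ← twistElement_mul hN hS, mul_smul, mul_smul, hc, hc] }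
  obtain ⟨s, hs0⟩ := exists_ne (0 : S)
  -- The diagonal matrix units add up to 1, so one of them does not kill s. Its column carries the
  -- copy of Kⁿ in S.
  obtain ⟨j, hj⟩ : ∃ j, schurLift R N w (Matrix.single j j 1) • s ≠ 0 := by
    by_contra! hcon
    apply hs0
    have h1 : (1 : Matrix (Fin n) (Fin n) K) = ∑ j, Matrix.single j j 1 := by
      simp [← Matrix.ext_iff, Matrix.sum_apply, Matrix.single_apply, Matrix.one_apply, ite_and]
    rw [← he s, h1, map_sum, Finset.sum_smul]
    exact Finset.sum_eq_zero fun j _ => hcon j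
  let φ := orbitMap R N w (Pi.single j 1) s
  have hφj : φ (Pi.single j 1) ≠ 0 := by
    have : Matrix.vecMulVec (Pi.single j 1) (Pi.single j (1 : K)) = Matrix.single j j 1 := by
      rw [Matrix.single_eq_single_vecMulVec_single]
    change schurLift R N w _ • s ≠ 0
    rwa [this]
  have hφ : ∀ g v, (MonoidAlgebra.single g 1 : MonoidAlgebra K G) • φ v =
      (c g : K) • φ ((R g).mulVec v) := fun g v => by
    rw [← he (φ v), ← mul_smul, single_mul_schurLift_eq hS, mul_one, mul_smul, hc,
      schurLift_smul_orbitMap hS]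
  refine ⟨χ₀.toHomUnits, fun h hh => ?_, φ, ⟨?_, ?_⟩, hφ⟩
  · ext
    change c h = 1
    exact hinj _ _ fun s => by rw [← hc, twistElement_of_mem hh, he, one_smul]
  · rw [← LinearMap.ker_eq_bot, eq_bot_iff]
    intro v hv
    by_contra hv0
    obtain ⟨i, hi⟩ := Function.ne_iff.1 hv0
    apply hφj
    have h1 : Pi.single j 1 = (Matrix.single j i (v i)⁻¹).mulVec v := by
      rw [Matrix.single_mulVec]
      simp at hi
      simp [hi, Pi.single]
    rw [h1, ← schurLift_smul_orbitMap hS]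
    rw [LinearMap.mem_ker] at hv
    exact (congrArg _ hv).trans (smul_zero _)
  · let P : Submodule (MonoidAlgebra K G) S :=
      { carrier := Set.range φ
        add_mem' := by rintro _ _ ⟨a, rfl⟩ ⟨b, rfl⟩; exact ⟨a + b, map_add _ _ _⟩
        zero_mem' := ⟨0, map_zero _⟩
        smul_mem' := by
          rintro x _ ⟨a, rfl⟩
          induction x using MonoidAlgebra.induction_linear with
          | zero => exact ⟨0, by simp⟩
          | add x y hx hy =>
            obtain ⟨b, hb⟩ := hx
            obtain ⟨b', hb'⟩ := hy
            exact ⟨b + b', by rw [map_add, hb, hb', add_smul]⟩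
          | single h b =>
            refine ⟨b • c h • (R h).mulVec a, ?_⟩
            rw [map_smul, map_smul, ← hφ, ← smul_assoc, MonoidAlgebra.smul_single, smul_eq_mul,
              mul_one] }
    have hP : P = ⊤ := (eq_bot_or_eq_top P).resolve_left fun h => hφj <| by
      have : φ (Pi.single j 1) ∈ P := ⟨_, rfl⟩
      rwa [h, Submodule.mem_bot] at this
    intro t
    have : t ∈ P := hP ▸ Submodule.mem_top
    exact this

/-! ### Linear algebra: commutative centralizers and cyclic vectors. -/

open Matrix in
/-- If the centralizer of a nilpotent matrix `x` in a corner `ε M_n(k) ε` is commutative, then the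
row space of `ε` is generated by one vector over `k[x]`. -/
theorem exists_vecMul_mem_span_of_commute {k : Type*} [Field k] {n : ℕ}
    {ε x : Matrix (Fin n) (Fin n) k} (hε : ε * ε = ε) (hεx : ε * x = x) (hxε : x * ε = x)
    (hx : IsNilpotent x)
    (hcomm : ∀ S T : Matrix (Fin n) (Fin n) k, ε * S = S → S * ε = S → x * S = S * x →
      ε * T = T → T * ε = T → x * T = T * x → S * T = T * S) :
    ∃ f : Fin n → k, ∀ g : Fin n → k,
      g ᵥ* ε ∈ Submodule.span k (Set.range fun i : ℕ => f ᵥ* (ε * x ^ i)) := by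
  classical
  by_cases hε0 : ε = 0
  · exact ⟨0, fun g => by simp [hε0]⟩
  have hex : ∃ m, ε * x ^ m = 0 := by
    obtain ⟨m, hm⟩ := hx
    exact ⟨m, by rw [hm, mul_zero]⟩
  let m := Nat.find hex
  have hm : ε * x ^ m = 0 := Nat.find_spec hex
  have hεxc : Commute ε x := hεx.trans hxε.symm
  have hcp : ∀ i, ε * x ^ i = x ^ i * ε := fun i => (hεxc.pow_right i).eq
  have hm0 : 0 < m := Nat.pos_of_ne_zero fun h => hε0 (by rw [h] at hm; simpa using hm)
  have hm1 : ε * x ^ (m - 1) ≠ 0 := Nat.find_min hex (Nat.sub_lt hm0 one_pos)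
  obtain ⟨i₀, j₀, hij⟩ : ∃ i j, (ε * x ^ (m - 1)) i j ≠ 0 := by
    by_contra! h
    exact hm1 (Matrix.ext h)
  let v₀ : Fin n → k := Pi.single j₀ 1
  -- The scaling makes f εx^(m−1) v₀ = 1, where m − 1 is the last exponent with εx^(m−1) ≠ 0.
  let f : Fin n → k := Pi.single i₀ ((ε * x ^ (m - 1)) i₀ j₀)⁻¹
  let a : ℕ → (Fin n → k) → k := fun i u => f ⬝ᵥ ((ε * x ^ (m - 1 - i)) *ᵥ u)
  have ha0 : a 0 v₀ = 1 := by
    simp only [a, v₀, f, Nat.sub_zero, Matrix.mulVec_single_one, single_dotProduct]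
    exact inv_mul_cancel₀ hij
  -- A rank-one operator u ⊗ f, made to commute with x: the commutator of the sum with x telescopes
  -- to two end terms that contain εx^m = 0.
  let T : (Fin n → k) → Matrix (Fin n) (Fin n) k := fun u =>
    ∑ i ∈ Finset.range m, x ^ i * (ε * vecMulVec u f * ε) * x ^ (m - 1 - i)
  have hT : ∀ u z, T u *ᵥ z = ∑ i ∈ Finset.range m, a i z • (x ^ i * ε) *ᵥ u := by
    intro u z
    simp only [T, Matrix.sum_mulVec]
    refine Finset.sum_congr rfl fun i _ => ?_
    have : x ^ i * (ε * vecMulVec u f * ε) * x ^ (m - 1 - i) =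
        (x ^ i * ε) * vecMulVec u f * (ε * x ^ (m - 1 - i)) := by simp only [mul_assoc]
    rw [this, ← mulVec_mulVec, ← mulVec_mulVec, vecMulVec_mulVec]
    simp [a, mulVec_smul]
  have hTε : ∀ u, T u * ε = T u := fun u => by
    simp only [T, Finset.sum_mul]
    refine Finset.sum_congr rfl fun i _ => ?_
    rw [mul_assoc, ← hcp, ← mul_assoc, mul_assoc _ _ ε, mul_assoc _ ε ε, hε]
  have hεT : ∀ u, ε * T u = T u := fun u => by
    simp only [T, Finset.mul_sum]
    refine Finset.sum_congr rfl fun i _ => ?_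
    rw [← mul_assoc, ← mul_assoc, hcp, mul_assoc (x ^ i), ← mul_assoc ε, ← mul_assoc ε, hε]
  have hxT : ∀ u, x * T u = T u * x := fun u => by
    let F : ℕ → Matrix (Fin n) (Fin n) k := fun i => x ^ i * (ε * vecMulVec u f * ε) * x ^ (m - i)
    have h1 : x * T u = ∑ i ∈ Finset.range m, F (i + 1) := by
      simp only [T, Finset.mul_sum, F]
      refine Finset.sum_congr rfl fun i _ => ?_
      rw [pow_succ', Nat.sub_sub, add_comm 1 i]
      simp only [mul_assoc]
    have h2 : T u * x = ∑ i ∈ Finset.range m, F i := by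
      simp only [T, Finset.sum_mul, F]
      refine Finset.sum_congr rfl fun i hi => ?_
      rw [mul_assoc _ _ x, ← pow_succ]
      congr 2
      have := Finset.mem_range.1 hi
      omega
    rw [h1, h2, ← sub_eq_zero, ← Finset.sum_sub_distrib, Finset.sum_range_sub]
    have h3 : F m = 0 := by
      simp only [F]
      rw [← mul_assoc, ← mul_assoc, ← hcp, hm]
      simp
    have h4 : F 0 = 0 := by
      simp only [F]
      rw [Nat.sub_zero, mul_assoc, mul_assoc _ ε, hm]
      simp
    rw [h3, h4, sub_zero]
  -- Chosen so that T u v₀ = q ε u. Its constant term is a 0 v₀ = 1, so q is 1 plus a nilpotent.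
  let q : Matrix (Fin n) (Fin n) k := ∑ i ∈ Finset.range m, a i v₀ • x ^ i
  have hq : IsUnit q := by
    have h1 : q = 1 + x * ∑ i ∈ Finset.range (m - 1), a (i + 1) v₀ • x ^ i := by
      have : m = m - 1 + 1 := by omega
      simp only [q]
      rw [this, Finset.sum_range_succ', ha0, Finset.mul_sum, add_comm]
      simp [pow_succ']
    rw [h1]
    refine IsNilpotent.isUnit_one_add (Commute.isNilpotent_mul_right ?_ hx)
    exact Commute.sum_right _ _ _ fun i _ => ((Commute.refl x).pow_right i).smul_right _
  have hqT : ∀ u, q * T u = T u * q := fun u => by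
    have : Commute (T u) x := (hxT u).symm
    exact (Commute.sum_right _ _ _ fun i _ => (this.pow_right i).smul_right _).eq.symm
  have hTv : ∀ u, T u *ᵥ v₀ = q *ᵥ ε *ᵥ u := fun u => by
    rw [hT]
    simp only [q, Matrix.sum_mulVec, smul_mulVec, ← mulVec_mulVec]
  -- Apply T v₀ · T u = T u · T v₀ to v₀ and cancel q twice: εu = q⁻¹ T v₀ u. Here u enters only
  -- through the functionals a i, which are rows f εx^(m−1−i).
  have key : ∀ u, ε *ᵥ u = ∑ i ∈ Finset.range m, a i u • ((q⁻¹ * (x ^ i * ε)) *ᵥ v₀) := by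
    intro u
    have h1 := hcomm (T v₀) (T u) (hεT _) (hTε _) (hxT _) (hεT _) (hTε _) (hxT _)
    have h2 := congrArg (· *ᵥ v₀) h1
    simp only [← mulVec_mulVec, hTv] at h2
    rw [mulVec_mulVec, ← hqT, ← mulVec_mulVec, mulVec_mulVec _ (T u), ← hqT, ← mulVec_mulVec,
      mulVec_mulVec _ (T u), hTε, hTv, mulVec_mulVec _ (T v₀), hTε] at h2
    have hq' : q⁻¹ * q = 1 := Matrix.nonsing_inv_mul q ((Matrix.isUnit_iff_isUnit_det q).1 hq)
    have h3 := congrArg (q⁻¹ *ᵥ ·) h2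
    simp only [mulVec_mulVec, ← mul_assoc, hq', one_mul] at h3
    have h4 := congrArg (q⁻¹ *ᵥ ·) h3
    simp only [mulVec_mulVec, ← mul_assoc, hq', one_mul] at h4
    rw [← h4, ← mulVec_mulVec, hT, mulVec_sum]
    simp only [mulVec_smul, mulVec_mulVec]
  refine ⟨f, fun g => ?_⟩
  have : g ᵥ* ε = ∑ i ∈ Finset.range m, (g ⬝ᵥ ((q⁻¹ * (x ^ i * ε)) *ᵥ v₀)) •
      (f ᵥ* (ε * x ^ (m - 1 - i))) := by
    refine dotProduct_eq _ _ fun u => ?_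
    rw [← dotProduct_mulVec, key, dotProduct_sum, sum_dotProduct]
    refine Finset.sum_congr rfl fun i _ => ?_
    rw [dotProduct_smul, smul_dotProduct, ← dotProduct_mulVec, smul_eq_mul, smul_eq_mul, mul_comm]
  rw [this]
  exact Submodule.sum_mem _ fun i _ => Submodule.smul_mem _ _ (Submodule.subset_span ⟨_, rfl⟩)

/-! ### The projection onto the ψ-eigenspace of L ∩ N. -/

section CharIdempotent

open scoped Classical in
/-- The sum `u * ∑_{h ∈ L ∩ N} ψ(h)⁻¹ R(h)`: for `u = #(L ∩ N)⁻¹` the projection onto the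
`ψ`-eigenspace of `L ∩ N`. -/
def charProj {A G : Type*} [CommRing A] [Group G] [Fintype G] {n : ℕ}
    (R : G →* Matrix (Fin n) (Fin n) A) (N L : Subgroup G) (ψ : L →* Aˣ) (u : A) :
    Matrix (Fin n) (Fin n) A :=
  u • ∑ h : L, if (h : G) ∈ N then ((ψ h)⁻¹ : Aˣ).1 • R h else 0

variable {A G : Type*} [CommRing A] [Group G] [Fintype G] {n : ℕ}
  {R : G →* Matrix (Fin n) (Fin n) A} {N L : Subgroup G} {ψ : L →* Aˣ} {u : A}

theorem mul_charProj {h : L} (hh : (h : G) ∈ N) :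
    R h * charProj R N L ψ u = (ψ h : A) • charProj R N L ψ u := by
  classical
  rw [charProj, mul_smul_comm, smul_comm (ψ h : A)]
  congr 1
  rw [Finset.mul_sum, Finset.smul_sum]
  refine Fintype.sum_equiv (Equiv.mulLeft h) _ _ fun g => ?_
  simp only [Equiv.coe_mulLeft, Subgroup.coe_mul, N.mul_mem_cancel_left hh]
  split_ifs
  · simp [smul_smul, mul_comm]
  · simp

theorem charProj_mul {h : L} (hh : (h : G) ∈ N) :
    charProj R N L ψ u * R h = (ψ h : A) • charProj R N L ψ u := by
  classical
  rw [charProj, smul_mul_assoc, smul_comm (ψ h : A)]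
  congr 1
  rw [Finset.sum_mul, Finset.smul_sum]
  refine Fintype.sum_equiv (Equiv.mulRight h) _ _ fun g => ?_
  simp only [Equiv.coe_mulRight, Subgroup.coe_mul, N.mul_mem_cancel_right hh]
  split_ifs
  · simp [smul_smul]
  · simp

/-- N is normal and ψ has commutative values, so ψ on L ∩ N is invariant under conjugation by L. -/
theorem charProj_comm (hN : N.Normal) (l : L) :
    R l * charProj R N L ψ u = charProj R N L ψ u * R l := by
  classical
  rw [charProj, mul_smul_comm, smul_mul_assoc, Finset.mul_sum, Finset.sum_mul]
  congr 1
  refine Fintype.sum_equiv (MulAut.conj l).toEquiv _ _ fun g => ?_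
  have h1 : ((l * g * l⁻¹ : L) : G) ∈ N ↔ (g : G) ∈ N := by
    push_cast
    rw [hN.mem_comm_iff]
    simp
  have h2 : ψ (l * g * l⁻¹) = ψ g := by rw [map_mul, map_mul, mul_right_comm, map_inv]; simp
  simp only [MulEquiv.toEquiv_eq_coe, MulEquiv.coe_toEquiv, MulAut.conj_apply, h1, h2]
  split_ifs
  · rw [mul_smul_comm, smul_mul_assoc, ← map_mul, ← map_mul]
    simp
  · simp

theorem card_mul_charProj (T : Matrix (Fin n) (Fin n) A)
    (hT : ∀ h : L, (h : G) ∈ N → R h * T = (ψ h : A) • T) :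
    charProj R N L ψ u * T = (u * Nat.card (N.subgroupOf L)) • T := by
  classical
  rw [charProj, smul_mul_assoc, Finset.sum_mul, mul_smul]
  congr 1
  have : ∀ h : L, (if (h : G) ∈ N then ((ψ h)⁻¹ : Aˣ).1 • R h else 0) * T =
      if h ∈ N.subgroupOf L then T else 0 := fun h => by
    rw [Subgroup.mem_subgroupOf]
    split_ifs with hh
    · rw [smul_mul_assoc, hT h hh, smul_smul, Units.inv_mul, one_smul]
    · simp
  rw [Finset.sum_congr rfl fun h _ => this h, ← Finset.sum_filter, Finset.sum_const,
    Nat.cast_smul_eq_nsmul]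
  congr 1
  rw [Nat.card_eq_fintype_card, Fintype.card_subtype]

theorem charProj_mul_self (hu : u * Nat.card (N.subgroupOf L) = 1) :
    charProj R N L ψ u * charProj R N L ψ u = charProj R N L ψ u := by
  rw [card_mul_charProj _ fun h hh => mul_charProj hh, hu, one_smul]

theorem charProj_map {B : Type*} [CommRing B] (f : A →+* B) :
    (charProj R N L ψ u).map f =
      charProj (mapRep f R) N L ((Units.map (f : A →* B)).comp ψ) (f u) := by
  classical
  ext i j
  simp [charProj, Matrix.sum_apply, apply_ite f, map_sum, Finset.mul_sum,
    apply_ite (fun M : Matrix (Fin n) (Fin n) _ => M i j)]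

/-- On the corner cut out by the projection, L ∩ N acts from both sides through the scalars ψ. -/
theorem commute_of_charProj_mul {T : Matrix (Fin n) (Fin n) A}
    (h1 : charProj R N L ψ u * T = T) (h2 : T * charProj R N L ψ u = T) {h : L}
    (hh : (h : G) ∈ N) : R h * T = T * R h := by
  rw [← h1, ← mul_assoc, mul_charProj hh, h1]
  conv_rhs => rw [← h2, mul_assoc, charProj_mul hh, mul_smul_comm, h2]
  rw [smul_mul_assoc, h1]

end CharIdempotent

/-! ### A vector generating the eigenspace over R(L). -/

section

open IsLocalRing

/-- A matrix over the residue field commuting with `R(L)` lifts to one over `O`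
commuting with `R(L)`. -/
theorem exists_lift_of_schurRel {O G : Type*} [CommRing O] [IsLocalRing O] [Group G] [Fintype G]
    {n : ℕ} {R : G →* Matrix (Fin n) (Fin n) O} {N L : Subgroup G} {w : O} (hN : N.Normal)
    (hS : SchurRel R N w) {T : Matrix (Fin n) (Fin n) (ResidueField O)}
    (hT : ∀ l ∈ L, mapRep (residue O) R l * T = T * mapRep (residue O) R l) :
    ∃ S : Matrix (Fin n) (Fin n) O, S.map (residue O) = T ∧ ∀ l ∈ L, R l * S = S * R l := by
  let y := schurLift (mapRep (residue O) R) N (residue O w) T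
  -- Under Φ, commuting with R(L) means having coefficients constant on L-conjugacy classes. Any
  -- set-theoretic lift of the coefficients keeps this, so no averaging over L, whose order may be
  -- divisible by p, is needed.
  have hy : ∀ l ∈ L, ∀ g, y.coeff (l * g * l⁻¹) = y.coeff g := by
    intro l hl g
    have h1 := single_mul_schurLift_comm (R := mapRep (residue O) R) (w := residue O w) hN l T
    rw [hT l hl, mul_assoc, ← map_mul, mul_inv_cancel, map_one, mul_one] at h1
    have h2 := congrArg (fun z => z.coeff (l * g)) h1
    simp only [MonoidAlgebra.coeff_single_mul_apply, MonoidAlgebra.coeff_mul_single_apply,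
      one_mul, mul_one, inv_mul_cancel_left] at h2
    exact h2.symm
  let s : ResidueField O → O := Function.surjInv residue_surjective
  have hs : ∀ a, residue O (s a) = a := Function.surjInv_eq residue_surjective
  refine ⟨∑ g : G, s (y.coeff g) • R g, ?_, fun l hl => ?_⟩
  · rw [← groupAlgebraEval_schurLift (hS.map (residue O)) T]
    have hy' : y = ∑ g : G, MonoidAlgebra.single g (y.coeff g) := by
      ext z
      classical
      simp [MonoidAlgebra.coeff_sum, MonoidAlgebra.coeff_single]
    change _ = groupAlgebraEval (mapRep (residue O) R) y
    conv_rhs => rw [hy', map_sum]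
    ext i j
    simp [Matrix.sum_apply, map_sum, hs]
  · rw [Finset.mul_sum, Finset.sum_mul]
    refine Fintype.sum_equiv (MulAut.conj l).toEquiv _ _ fun g => ?_
    simp only [MulEquiv.toEquiv_eq_coe, MulEquiv.coe_toEquiv, MulAut.conj_apply, hy l hl]
    rw [mul_smul_comm, smul_mul_assoc, ← map_mul, ← map_mul]
    simp

end

open IsLocalRing Matrix in
/-- Over a local ring whose residue field has characteristic `p`, the row space of the projection
onto the `ψ`-eigenspace of `L ∩ N` is generated by one vector over `R(L)`, as soon as `L` is
generated by a `p`-element modulo `L ∩ N` and the `R(L)`-endomorphisms of the eigenspace commute. -/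
theorem exists_vecMul_charProj_mem_span {O G : Type*} [CommRing O] [IsLocalRing O] [Group G]
    [Fintype G] {n p : ℕ} [Fact p.Prime] [CharP (ResidueField O) p]
    {R : G →* Matrix (Fin n) (Fin n) O} {N L : Subgroup G} {w u : O} {ψ : L →* Oˣ}
    (hN : N.Normal) (hS : SchurRel R N w) (hu : u * Nat.card (N.subgroupOf L) = 1)
    {c : L} (hc : ∀ l : L, ∃ j : ℕ, ((c : G) ^ j)⁻¹ * l ∈ N) (hcp : ∃ a : ℕ, (c : G) ^ p ^ a ∈ N)
    (hcomm : ∀ S T : Matrix (Fin n) (Fin n) O,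
      (∀ l ∈ L, R l * S = S * R l) → charProj R N L ψ u * S = S → S * charProj R N L ψ u = S →
      (∀ l ∈ L, R l * T = T * R l) → charProj R N L ψ u * T = T → T * charProj R N L ψ u = T →
      S * T = T * S) :
    ∃ f : Fin n → O, ∀ g : Fin n → O, g ᵥ* charProj R N L ψ u ∈
      Submodule.span O (Set.range fun l : L => f ᵥ* (charProj R N L ψ u * R l)) := by
  classical
  let k := ResidueField O
  let R' := mapRep (residue O) R
  let ψ' : L →* kˣ := (Units.map (residue O : O →* k)).comp ψ
  let ε := charProj R N L ψ u
  let ε' : Matrix (Fin n) (Fin n) k := charProj R' N L ψ' (residue O u)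
  have hεε' : ε.map (residue O) = ε' := charProj_map (residue O)
  have hε : ε * ε = ε := charProj_mul_self hu
  have hu' : residue O u * Nat.card (N.subgroupOf L) = 1 := by
    rw [← map_natCast (residue O), ← map_mul, hu, map_one]
  have hε' : ε' * ε' = ε' := charProj_mul_self hu'
  have hεl : ∀ l : L, R' l * ε' = ε' * R' l := charProj_comm hN
  -- After this normalisation some p^a-th power of b is the identity on the eigenspace. In
  -- characteristic p this makes (b − 1)ε' nilpotent.
  let b : Matrix (Fin n) (Fin n) k := ((ψ' c)⁻¹ : kˣ).1 • R' c
  have hb : b * ε' = ε' * b := by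
    simp only [b]
    rw [smul_mul_assoc, mul_smul_comm, hεl]
  let x := (b - 1) * ε'
  have hxε : x * ε' = x := by simp only [x]; rw [mul_assoc, hε']
  have hbε : Commute (b - 1) ε' := by
    change (b - 1) * ε' = ε' * (b - 1)
    rw [sub_mul, mul_sub, hb, one_mul, mul_one]
  have hεx : ε' * x = x := by
    simp only [x]; rw [hbε.eq, ← mul_assoc, hε']
  have hnil : IsNilpotent x := by
    by_cases hn : n = 0
    · subst hn
      exact ⟨1, Subsingleton.elim _ _⟩
    have : Nonempty (Fin n) := ⟨⟨0, Nat.pos_of_ne_zero hn⟩⟩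
    obtain ⟨a, ha⟩ := hcp
    refine ⟨p ^ a, ?_⟩
    have hpa : p ^ a ≠ 0 := pow_ne_zero _ (Fact.out : p.Prime).ne_zero
    have hid : IsIdempotentElem ε' := hε'
    simp only [x]
    rw [hbε.mul_pow, sub_pow_char_pow_of_commute _ _ (Commute.one_right b), one_pow,
      hid.pow_eq hpa, sub_mul, one_mul]
    have h1 : b ^ p ^ a = ((ψ' (c ^ p ^ a))⁻¹ : kˣ).1 • R' ((c ^ p ^ a : L) : G) := by
      simp only [b]
      rw [smul_pow, Subgroup.coe_pow, map_pow, map_pow, ← Units.val_pow_eq_pow_val, inv_pow]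
    rw [h1, smul_mul_assoc, mul_charProj (by simpa using ha), smul_smul, Units.inv_mul, one_smul,
      sub_self]
  obtain ⟨f', hf'⟩ := exists_vecMul_mem_span_of_commute hε' hεx hxε hnil (by
    -- In the corner, commuting with x means commuting with R'(c), and L ∩ N acts by scalars, so S
    -- commutes with all of R'(L). It then lifts to O, and is cut down by ε on both sides.
    have key : ∀ S : Matrix (Fin n) (Fin n) k, ε' * S = S → S * ε' = S → x * S = S * x →
        ∃ S₀ : Matrix (Fin n) (Fin n) O, S₀.map (residue O) = S ∧ (∀ l ∈ L, R l * S₀ = S₀ * R l) ∧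
          ε * S₀ = S₀ ∧ S₀ * ε = S₀ := by
      intro S h1 h2 h3
      have h4 : ∀ h : L, (h : G) ∈ N → R' h * S = S * R' h := fun h hh =>
        commute_of_charProj_mul h1 h2 hh
      have h5 : R' c * S = S * R' c := by
        simp only [x] at h3
        rw [mul_assoc, h1, hbε.eq, ← mul_assoc, h2, sub_mul, mul_sub, one_mul, mul_one,
          sub_left_inj] at h3
        simp only [b] at h3
        rw [smul_mul_assoc, mul_smul_comm] at h3
        exact smul_right_injective _ (ψ' c)⁻¹.ne_zero h3
      have h6 : ∀ l ∈ L, R' l * S = S * R' l := by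
        intro l hl
        obtain ⟨j, hj⟩ := hc ⟨l, hl⟩
        have h7 : l = (c : G) ^ j * (((c : G) ^ j)⁻¹ * l) := by group
        have h8 : Commute (R' ((c : G) ^ j)) S := by
          rw [map_pow]
          exact Commute.pow_left h5 j
        have h9 : Commute (R' (((c : G) ^ j)⁻¹ * l)) S :=
          h4 ⟨_, L.mul_mem (L.inv_mem (L.pow_mem c.2 j)) hl⟩ hj
        rw [h7, map_mul]
        exact h8.mul_left h9
      obtain ⟨S₀, hS₀, hS₀l⟩ := exists_lift_of_schurRel hN hS h6
      refine ⟨ε * S₀ * ε, ?_, fun l hl => ?_, ?_, ?_⟩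
      · rw [Matrix.map_mul, Matrix.map_mul, hS₀, hεε', h1, h2]
      · have hl1 : Commute (R l) ε := charProj_comm hN ⟨l, hl⟩
        have hl2 : Commute (R l) S₀ := hS₀l l hl
        exact (hl1.mul_right hl2).mul_right hl1
      · rw [← mul_assoc, ← mul_assoc, hε]
      · rw [mul_assoc, hε]
    intro S T hS1 hS2 hS3 hT1 hT2 hT3
    obtain ⟨S₀, rfl, h1, h2, h3⟩ := key S hS1 hS2 hS3
    obtain ⟨T₀, rfl, h4, h5, h6⟩ := key T hT1 hT2 hT3
    rw [← Matrix.map_mul, ← Matrix.map_mul, hcomm S₀ T₀ h1 h2 h3 h4 h5 h6])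
  -- Right multiplication by x is a combination of R'(c) and 1 on the row space, so the span of the
  -- L-orbit contains the k[x]-orbit.
  have hstab : ∀ i : ℕ, f' ᵥ* (ε' * x ^ i) ∈
      Submodule.span k (Set.range fun l : L => f' ᵥ* (ε' * R' l)) := by
    intro i
    induction i with
    | zero => exact Submodule.subset_span ⟨1, by simp⟩
    | succ i ih =>
      rw [pow_succ, ← mul_assoc, ← vecMul_vecMul]
      generalize f' ᵥ* (ε' * x ^ i) = z at ih ⊢
      induction ih using Submodule.span_induction with
      | zero => rw [zero_vecMul]; exact zero_mem _
      | add y z _ _ hy hz => rw [add_vecMul]; exact add_mem hy hz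
      | smul a y _ hy => rw [smul_vecMul]; exact Submodule.smul_mem _ _ hy
      | mem y hy =>
        obtain ⟨l, rfl⟩ := hy
        have h1 : ε' * R' l * x =
            ((ψ' c)⁻¹ : kˣ).1 • (ε' * R' ((l * c : L) : G)) - ε' * R' l := by
          rw [← hεl, mul_assoc, hεx]
          simp only [x]
          rw [hbε.eq, ← mul_assoc, hεl, mul_sub, mul_one]
          simp only [b]
          rw [mul_smul_comm, mul_assoc, ← map_mul, Subgroup.coe_mul]
        simp only [vecMul_vecMul]
        rw [h1, vecMul_sub, vecMul_smul]
        exact sub_mem (Submodule.smul_mem _ _ (Submodule.subset_span ⟨_, rfl⟩))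
          (Submodule.subset_span ⟨_, rfl⟩)
  have hspan : ∀ g : Fin n → k, g ᵥ* ε' ∈
      Submodule.span k (Set.range fun l : L => f' ᵥ* (ε' * R' l)) := fun g => by
    refine Submodule.span_le.2 ?_ (hf' g)
    rintro _ ⟨i, rfl⟩
    exact hstab i
  obtain ⟨f, rfl⟩ : ∃ f : Fin n → O, residue O ∘ f = f' :=
    ⟨Function.surjInv residue_surjective ∘ f', by
      ext i; simp [Function.surjInv_eq residue_surjective]⟩
  refine ⟨f, fun g => ?_⟩
  let W := Submodule.span O (Set.range fun l : L => f ᵥ* (ε * R l))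
  let E : Submodule O (Fin n → O) := LinearMap.range ε.vecMulLinear
  have hred : ∀ (g : Fin n → O) (M : Matrix (Fin n) (Fin n) O),
      residue O ∘ (g ᵥ* M) = (residue O ∘ g) ᵥ* M.map (residue O) := fun g M => by
    ext i; exact RingHom.map_vecMul _ _ _ _
  have hWE : W ≤ E := by
    refine Submodule.span_le.2 ?_
    rintro _ ⟨l, rfl⟩
    refine ⟨f ᵥ* R l, ?_⟩
    change (f ᵥ* R l) ᵥ* ε = f ᵥ* (ε * R l)
    rw [vecMul_vecMul, ← charProj_comm hN l]
  have hlift : ∀ z ∈ Submodule.span k (Set.range fun l : L => (residue O ∘ f) ᵥ* (ε' * R' l)),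
      ∃ y ∈ W, residue O ∘ y = z := by
    intro z hz
    induction hz using Submodule.span_induction with
    | zero => exact ⟨0, zero_mem _, by ext; simp⟩
    | add y z _ _ hy hz =>
      obtain ⟨y, hy, rfl⟩ := hy
      obtain ⟨z, hz, rfl⟩ := hz
      exact ⟨y + z, add_mem hy hz, by ext; simp⟩
    | smul a y _ hy =>
      obtain ⟨y, hy, rfl⟩ := hy
      obtain ⟨a, rfl⟩ := residue_surjective a
      exact ⟨a • y, Submodule.smul_mem _ _ hy, by ext; simp⟩
    | mem y hy =>
      obtain ⟨l, rfl⟩ := hy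
      refine ⟨_, Submodule.subset_span ⟨l, rfl⟩, ?_⟩
      rw [hred, Matrix.map_mul, hεε']
      rfl
  -- Nakayama for the row space E of ε. The error d has entries in the maximal ideal and satisfies
  -- dε = d, so it lies in the maximal ideal times E itself.
  have hEW : E ≤ W := by
    refine Submodule.le_of_le_smul_of_le_jacobson_bot (I := maximalIdeal O)
      (Module.Finite.iff_fg.1 inferInstance)
      (IsLocalRing.jacobson_eq_maximalIdeal ⊥ bot_ne_top).ge ?_
    rintro _ ⟨g, rfl⟩
    obtain ⟨y, hy, hyg⟩ := hlift _ (hspan (residue O ∘ g))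
    have hd : ∀ i, (g ᵥ* ε - y) i ∈ maximalIdeal O := fun i => by
      rw [← residue_eq_zero_iff, Pi.sub_apply, map_sub, sub_eq_zero]
      have := (hred g ε).trans ((congrArg _ hεε').trans hyg.symm)
      exact congrFun this i
    have hdE : (g ᵥ* ε - y) ᵥ* ε = g ᵥ* ε - y := by
      obtain ⟨z, hz⟩ := hWE hy
      have hz : z ᵥ* ε = y := hz
      rw [← hz, ← sub_vecMul, vecMul_vecMul, hε]
    have h2 : g ᵥ* ε - y ∈ maximalIdeal O • E := by
      rw [← hdE]
      conv => arg 2; rw [pi_eq_sum_univ (g ᵥ* ε - y)]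
      rw [sum_vecMul]
      refine Submodule.sum_mem _ fun i _ => ?_
      rw [smul_vecMul]
      exact Submodule.smul_mem_smul (hd i) ⟨_, rfl⟩
    change g ᵥ* ε ∈ _
    rw [show g ᵥ* ε = y + (g ᵥ* ε - y) by abel]
    exact Submodule.add_mem_sup hy h2
  exact hEW ⟨g, rfl⟩

/-! ### Induced modules and Frobenius reciprocity. -/

section Ind

variable {A G V : Type*} [CommRing A] [Group G] [AddCommGroup V] [Module A V] {H : Subgroup G}
  {σ : Representation A H V}

/-- A linear map out of an induced representation. -/
def indLift {W : Type*} [AddCommGroup W] [Module A W] (F : G → V →ₗ[A] W)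
    (hF : ∀ (l : H) g v, F (l * g) (σ l v) = F g v) :
    Representation.IndV H.subtype σ →ₗ[A] W :=
  Representation.Coinvariants.lift _
    (TensorProduct.lift ((Finsupp.lift _ _ _ F) ∘ₗ
      (MonoidAlgebra.coeffLinearEquiv A).toLinearMap)) fun l => by
    ext g v
    simp [hF]

theorem indLift_mk {W : Type*} [AddCommGroup W] [Module A W] (F : G → V →ₗ[A] W)
    (hF : ∀ (l : H) g v, F (l * g) (σ l v) = F g v) (g : G) (v : V) :
    indLift F hF (Representation.IndV.mk H.subtype σ g v) = F g v := by
  simp [indLift]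

variable (H σ) in
/-- The canonical map from `σ` to the module induced by it. -/
def indOf : V →ₗ[A] IndModule H σ :=
  (Representation.asModuleEquiv _).symm.toLinearMap ∘ₗ Representation.IndV.mk H.subtype σ 1

theorem single_smul_indOf (g : G) (v : V) :
    (MonoidAlgebra.single g 1 : MonoidAlgebra A G) • indOf H σ v =
      (Representation.asModuleEquiv _).symm (Representation.IndV.mk H.subtype σ g⁻¹ v) := by
  rw [single_one_smul_asModule]
  congr 1
  have := Representation.ind_mk H.subtype σ g 1 v
  rw [one_mul] at this
  exact this

theorem indOf_apply (l : H) (v : V) :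
    indOf H σ (σ l v) = (MonoidAlgebra.single (l : G) 1 : MonoidAlgebra A G) • indOf H σ v := by
  rw [single_smul_indOf]
  change (Representation.asModuleEquiv _).symm (Representation.IndV.mk H.subtype σ 1 (σ l v)) = _
  congr 1
  have := Representation.Coinvariants.mk_self_apply
    (Representation.tprod ((Representation.leftRegular A G).comp H.subtype) σ) l
    (MonoidAlgebra.single (l : G)⁻¹ 1 ⊗ₜ v)
  simpa using this

theorem indModule_induction {P : IndModule H σ → Prop} (hadd : ∀ x y, P x → P y → P (x + y))
    (h : ∀ (g : G) v, P ((MonoidAlgebra.single g 1 : MonoidAlgebra A G) • indOf H σ v))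
    (x : IndModule H σ) : P x := by
  have h0 : P 0 := by simpa using h 1 0
  have h' : ∀ (g : G) v, P ((Representation.asModuleEquiv _).symm
      (Representation.IndV.mk H.subtype σ g v)) := fun g v => by
    have := h g⁻¹ v
    rwa [single_smul_indOf, inv_inv] at this
  obtain ⟨t, ht⟩ := Representation.Coinvariants.mk_surjective _
    (Representation.asModuleEquiv (Representation.ind H.subtype σ) x)
  have hx : x = (Representation.asModuleEquiv (Representation.ind H.subtype σ)).symm
      (Representation.Coinvariants.mk _ t) := by
    rw [ht, LinearEquiv.symm_apply_apply]
  rw [hx]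
  clear hx ht
  induction t using TensorProduct.induction_on with
  | zero => simpa using h0
  | add y z hy hz => rw [map_add, map_add]; exact hadd _ _ hy hz
  | tmul y v =>
    induction y using MonoidAlgebra.induction_linear with
    | zero => simpa using h0
    | add y z hy hz => rw [TensorProduct.add_tmul, map_add, map_add]; exact hadd _ _ hy hz
    | single g a =>
      have h1 : (MonoidAlgebra.single g a : MonoidAlgebra A G) = a • MonoidAlgebra.single g 1 := by
        simp
      rw [h1, TensorProduct.smul_tmul]
      exact h' g (a • v)

/-- The maps `v ↦ g⁻¹ φ(v)`. -/
def invTranslate (G : Type*) [Group G] {M : Type*} [AddCommGroup M] [Module A M]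
    [Module (MonoidAlgebra A G) M] [IsScalarTower A (MonoidAlgebra A G) M] (φ : V →ₗ[A] M) (g : G) :
    V →ₗ[A] M where
  toFun v := (MonoidAlgebra.single g⁻¹ 1 : MonoidAlgebra A G) • φ v
  map_add' u v := by rw [map_add, smul_add]
  map_smul' a v := by rw [map_smul, smul_algebra_smul_comm]; rfl

theorem invTranslate_mul {M : Type*} [AddCommGroup M] [Module A M] [Module (MonoidAlgebra A G) M]
    [IsScalarTower A (MonoidAlgebra A G) M] (φ : V →ₗ[A] M)
    (hφ : ∀ (l : H) v, φ (σ l v) = (MonoidAlgebra.single (l : G) 1 : MonoidAlgebra A G) • φ v)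
    (l : H) (g : G) (v : V) : invTranslate G φ (l * g) (σ l v) = invTranslate G φ g v := by
  change (MonoidAlgebra.single (l * g)⁻¹ 1 : MonoidAlgebra A G) • φ (σ l v) = _
  rw [hφ, ← mul_smul, MonoidAlgebra.single_mul_single]
  simp [invTranslate]

/-- Frobenius reciprocity: the homomorphism out of an induced module that extends `φ`. -/
def indHom {M : Type*} [AddCommGroup M] [Module A M] [Module (MonoidAlgebra A G) M]
    [IsScalarTower A (MonoidAlgebra A G) M] (φ : V →ₗ[A] M)
    (hφ : ∀ (l : H) v, φ (σ l v) = (MonoidAlgebra.single (l : G) 1 : MonoidAlgebra A G) • φ v) :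
    IndModule H σ →ₗ[MonoidAlgebra A G] M := by
  let F₀ : Representation.IndV H.subtype σ →ₗ[A] M :=
    indLift (σ := σ) (invTranslate G φ) (invTranslate_mul φ hφ)
  exact
    { toFun := fun x => F₀ (Representation.asModuleEquiv _ x)
      map_add' := fun x y => by rw [map_add, map_add]
      map_smul' := fun a x => by
        have hF : ∀ g v, F₀ (Representation.asModuleEquiv (Representation.ind H.subtype σ)
            ((MonoidAlgebra.single g 1 : MonoidAlgebra A G) • indOf H σ v)) =
              (MonoidAlgebra.single g 1 : MonoidAlgebra A G) • φ v := fun g v => by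
          rw [single_smul_indOf, LinearEquiv.apply_symm_apply]
          refine (indLift_mk _ _ _ _).trans ?_
          change (MonoidAlgebra.single g⁻¹⁻¹ 1 : MonoidAlgebra A G) • φ v = _
          rw [inv_inv]
        rw [RingHom.id_apply]
        induction a using MonoidAlgebra.induction_linear with
        | zero => simp
        | add a b ha hb => rw [add_smul, map_add, map_add, ha, hb, add_smul]
        | single h a =>
          induction x using indModule_induction with
          | hadd x y hx hy => rw [smul_add, map_add, map_add, hx, hy, map_add, map_add, smul_add]
          | h g v =>
            have h1 : (MonoidAlgebra.single h a : MonoidAlgebra A G) =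
                a • MonoidAlgebra.single h 1 := by simp
            rw [h1, smul_assoc, smul_assoc, ← mul_smul, MonoidAlgebra.single_mul_single, mul_one,
              map_smul, map_smul, hF, hF, ← mul_smul, MonoidAlgebra.single_mul_single, mul_one] }

theorem indHom_indOf {M : Type*} [AddCommGroup M] [Module A M] [Module (MonoidAlgebra A G) M]
    [IsScalarTower A (MonoidAlgebra A G) M] (φ : V →ₗ[A] M)
    (hφ : ∀ (l : H) v, φ (σ l v) = (MonoidAlgebra.single (l : G) 1 : MonoidAlgebra A G) • φ v)
    (v : V) : indHom φ hφ (indOf H σ v) = φ v := by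
  refine (indLift_mk (invTranslate G φ) (invTranslate_mul φ hφ) 1 v).trans ?_
  change (MonoidAlgebra.single 1⁻¹ 1 : MonoidAlgebra A G) • φ v = _
  rw [inv_one, ← MonoidAlgebra.one_def, one_smul]

end Ind

/-! ### Endomorphisms of multiplicity free modules. -/

section MultiplicityFree

variable {B M : Type*} [Ring B] [AddCommGroup M] [Module B M]

/-- Endomorphisms preserve the simple summands of a multiplicity free module. -/
theorem apply_mem_of_multiplicityFree {𝒮 : Set (Submodule B M)} (hind : sSupIndep 𝒮)
    (htop : sSup 𝒮 = ⊤) (hsimple : ∀ S ∈ 𝒮, IsSimpleModule B S)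
    (hiso : ∀ S ∈ 𝒮, ∀ T ∈ 𝒮, Nonempty (S ≃ₗ[B] T) → S = T)
    (f : Module.End B M) {S : Submodule B M} (hS : S ∈ 𝒮) {s : M} (hs : s ∈ S) : f s ∈ S := by
  let C := sSup (𝒮 \ {S})
  have hC : IsCompl S C := by
    refine ⟨hind hS, codisjoint_iff.2 ?_⟩
    rw [← htop, ← sSup_singleton (a := S)]
    simp only [C]
    rw [sSup_singleton, ← sSup_insert, Set.insert_sdiff_singleton, Set.insert_eq_of_mem hS]
  have := hsimple S hS
  -- The component of f on S in the complement C. If it were nonzero it would embed S into the sum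
  -- of the other summands, making S isomorphic to one of them.
  let g : S →ₗ[B] M := (C.projection S hC.symm) ∘ₗ f ∘ₗ S.subtype
  have hg : g = 0 := by
    by_contra h0
    have hinj : Function.Injective g := LinearMap.injective_of_ne_zero h0
    let e : S ≃ₗ[B] LinearMap.range g := LinearEquiv.ofInjective g hinj
    have hr : IsSimpleModule B (LinearMap.range g) := IsSimpleModule.congr e.symm
    have hle : LinearMap.range g ≤ C := by
      rintro _ ⟨x, rfl⟩
      exact Submodule.projection_apply_mem _ _
    have hsm : ∀ m : (𝒮 \ {S} : Set (Submodule B M)), IsSimpleModule B m := fun m =>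
      hsimple m m.2.1
    obtain ⟨T, hT, ⟨e'⟩⟩ := Submodule.linearEquiv_of_le_sSup (LinearMap.range g) (𝒮 \ {S}) hle
    exact hT.2 (hiso S hS T hT.1 ⟨e.trans e'⟩).symm
  have h1 : C.projection S hC.symm (f s) = 0 := LinearMap.congr_fun hg ⟨s, hs⟩
  rwa [Submodule.projection_apply_eq_zero_iff] at h1

/-- Endomorphisms preserve each simple summand, and e acts on it as 0 or 1. Only the endomorphism
rings of the summands with e = 1 matter. -/
theorem IsMultiplicityFree.smul_apply_comm (h : IsMultiplicityFree B M) (e : Subring.center B)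
    (he : IsIdempotentElem e)
    (hcomm : ∀ S : Submodule B M, IsSimpleModule B S → (∀ s : S, (e : B) • s = s) →
      ∀ f f' : Module.End B S, f * f' = f' * f) (f f' : Module.End B M) (m : M) :
    (e : B) • f (f' m) = (e : B) • f' (f m) := by
  obtain ⟨𝒮, hind, htop, hsimple, hiso⟩ := h
  have hle : sSup 𝒮 ≤ LinearMap.eqLocus (centralMul e M ∘ₗ f ∘ₗ f')
      (centralMul e M ∘ₗ f' ∘ₗ f) := by
    refine sSup_le fun S hS s hs => ?_
    change (e : B) • f (f' s) = (e : B) • f' (f s)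
    have hSs := hsimple S hS
    have hmem : ∀ (f : Module.End B M) (s : M), s ∈ S → f s ∈ S := fun f s hs =>
      apply_mem_of_multiplicityFree hind htop hsimple hiso f hS hs
    have hee : ∀ s : S, (e : B) • (e : B) • s = (e : B) • s := fun s => by
      rw [← mul_smul]
      exact congrArg (· • s) (congrArg Subtype.val he.eq)
    rcases eq_bot_or_eq_top (LinearMap.range (centralMul e S)) with h0 | h1
    · have h0' : ∀ s : M, s ∈ S → (e : B) • s = 0 := fun s hs => by
        have : centralMul e S ⟨s, hs⟩ = 0 := by
          rw [LinearMap.range_eq_bot] at h0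
          rw [h0]; rfl
        exact congrArg Subtype.val this
      rw [h0' _ (hmem f _ (hmem f' _ hs)), h0' _ (hmem f' _ (hmem f _ hs))]
    · have h1' : ∀ s : S, (e : B) • s = s := fun s => by
        obtain ⟨t, rfl⟩ := LinearMap.range_eq_top.1 h1 s
        exact hee t
      have := hcomm S hSs h1' (f.restrict (hmem f)) (f'.restrict (hmem f'))
      have h2 := congrArg Subtype.val (LinearMap.congr_fun this ⟨s, hs⟩)
      exact congrArg ((e : B) • ·) h2
  have : m ∈ sSup 𝒮 := htop ▸ Submodule.mem_top
  exact hle this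

end MultiplicityFree

/-! ### The Φ(1)-component of the module induced by ψ. -/

section

variable {A G : Type*} [CommRing A] [Group G] {n : ℕ}
  {R : G →* Matrix (Fin n) (Fin n) A} {N L : Subgroup G} {w u : A} {ψ : L →* Aˣ}

variable (ψ) in
/-- The generator of the module induced by a character. -/
def indGen : IndModule L (charRep ψ) := indOf L (charRep ψ) 1

theorem charRep_apply (l : L) (a : A) : charRep ψ l a = (ψ l : A) * a := rfl

theorem single_smul_indGen (l : L) :
    (MonoidAlgebra.single (l : G) 1 : MonoidAlgebra A G) • indGen ψ = (ψ l : A) • indGen ψ := by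
  rw [indGen, ← indOf_apply, charRep_apply, ← smul_eq_mul, map_smul]

theorem indOf_eq_smul_indGen (a : A) : indOf L (charRep ψ) a = a • indGen ψ := by
  rw [indGen, ← map_smul, smul_eq_mul, mul_one]

/-- L ∩ N acts on the generator through ψ, so Φ(T) times the generator sees only the part of T on
the eigenspace. -/
theorem schurLift_mul_charProj_smul_indGen [Fintype G] (hu : u * Nat.card (N.subgroupOf L) = 1)
    (T : Matrix (Fin n) (Fin n) A) :
    schurLift R N w (T * charProj R N L ψ u) • indGen ψ = schurLift R N w T • indGen ψ := by
  classical
  rw [charProj, mul_smul_comm, Finset.mul_sum, map_smul, map_sum, smul_assoc, Finset.sum_smul]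
  have : ∀ h : L, schurLift R N w (T * if (h : G) ∈ N then ((ψ h)⁻¹ : Aˣ).1 • R h else 0) •
      indGen ψ = if h ∈ N.subgroupOf L then schurLift R N w T • indGen ψ else 0 := fun h => by
    rw [Subgroup.mem_subgroupOf]
    split_ifs with hh
    · rw [mul_smul_comm, map_smul, ← schurLift_mul_single hh, smul_assoc, mul_smul,
        single_smul_indGen, smul_algebra_smul_comm, smul_smul, Units.inv_mul, one_smul]
    · simp
  rw [Finset.sum_congr rfl fun h _ => this h, ← Finset.sum_filter, Finset.sum_const,
    ← Fintype.card_subtype, ← Nat.cast_smul_eq_nsmul A, smul_smul]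
  rw [Nat.card_eq_fintype_card] at hu
  convert one_smul A _

/-- Right multiplication by R(l) becomes the action of an element of the group algebra, so
submodules absorb it. This is why a generator under R(L) suffices. -/
theorem schurLift_mul_smul_indGen [Fintype G] (hN : N.Normal) (hS : SchurRel R N w) (l : L)
    (T : Matrix (Fin n) (Fin n) A) :
    schurLift R N w (T * R l) • indGen ψ =
      (ψ l : A) • twistElement R N w (l : G)⁻¹ • schurLift R N w T • indGen ψ := by
  have h1 : twistElement R N w (l : G)⁻¹ * schurLift R N w T * MonoidAlgebra.single (l : G) 1 =
      schurLift R N w (T * R l) := by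
    rw [twistElement_mul_schurLift hS, inv_inv, mul_assoc, schurLift_mul_single_comm hN,
      ← mul_assoc, MonoidAlgebra.single_mul_single, inv_mul_cancel, mul_one,
      ← MonoidAlgebra.one_def, one_mul, ← mul_assoc, ← map_mul, inv_mul_cancel, map_one, one_mul]
  rw [← h1, mul_smul, single_smul_indGen, mul_smul, smul_algebra_smul_comm, smul_algebra_smul_comm]

/-- Converse to `schurLift_mul_charProj_smul_indGen`. The map F out of the induced module, supported
on LN, recovers T·`charProj`, up to the factor u, from Φ(T) times the generator. -/
theorem mul_charProj_eq_zero [Fintype G] (hS : SchurRel R N w) {T : Matrix (Fin n) (Fin n) A}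
    (hT : schurLift R N w T • indGen ψ = 0) : T * charProj R N L ψ u = 0 := by
  classical
  let F : G → A →ₗ[A] Matrix (Fin n) (Fin n) A := fun g =>
    LinearMap.toSpanSingleton A _
      (∑ l : L, if (l * g : G) ∈ N then (ψ l : A) • R (l * g : G)⁻¹ else 0)
  have hF : ∀ (l : L) (g : G) (a : A), F (l * g) (charRep ψ l a) = F g a := by
    intro l g a
    simp only [F, LinearMap.toSpanSingleton_apply, charRep_apply]
    rw [mul_comm, mul_smul]
    congr 1
    rw [Finset.smul_sum]
    refine Fintype.sum_equiv (Equiv.mulRight l) _ _ fun h => ?_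
    simp only [Equiv.coe_mulRight, Subgroup.coe_mul, mul_assoc, map_mul, Units.val_mul]
    split_ifs
    · rw [smul_smul, mul_comm]
    · simp
  have h1 : (Representation.asModuleEquiv _ (schurLift R N w T • indGen ψ)) =
      ∑ g : G, (schurLift R N w T).coeff g • Representation.IndV.mk L.subtype (charRep ψ) g⁻¹ 1 :=
          by
    have hx : schurLift R N w T =
        ∑ g : G, (schurLift R N w T).coeff g • MonoidAlgebra.single g 1 := by
      ext z
      simp [MonoidAlgebra.coeff_sum, MonoidAlgebra.coeff_single]
    conv_lhs => rw [hx]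
    rw [Finset.sum_smul, map_sum]
    refine Finset.sum_congr rfl fun g _ => ?_
    rw [smul_assoc, indGen, single_smul_indOf, map_smul, LinearEquiv.apply_symm_apply]
  have h2 := congrArg (indLift F hF) h1
  rw [hT, map_zero, map_zero, map_sum] at h2
  have h3 : ∀ g : G, indLift F hF ((schurLift R N w T).coeff g •
      Representation.IndV.mk L.subtype (charRep ψ) g⁻¹ 1) =
      (schurLift R N w T).coeff g • (R g *
        ∑ h : L, if (h : G) ∈ N then ((ψ h)⁻¹ : Aˣ).1 • R h else 0) := by
    intro g
    rw [map_smul, indLift_mk]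
    by_cases hg : g ∈ N
    · congr 1
      simp only [F, LinearMap.toSpanSingleton_apply, one_smul]
      rw [Finset.mul_sum]
      refine Fintype.sum_equiv (Equiv.inv L) _ _ fun h => ?_
      simp only [Equiv.inv_apply, N.mul_mem_cancel_right (N.inv_mem hg), Subgroup.coe_inv,
        N.inv_mem_iff]
      split_ifs
      · rw [mul_smul_comm, ← map_mul]
        simp
      · simp
    · rw [coeff_schurLift, if_neg hg, zero_smul, zero_smul]
  rw [Finset.sum_congr rfl fun g _ => h3 g] at h2
  rw [charProj, mul_smul_comm]
  have h4 : T = ∑ g : G, (schurLift R N w T).coeff g • R g := by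
    conv_lhs => rw [← groupAlgebraEval_schurLift hS T]
    rw [groupAlgebraEval, MonoidAlgebra.lift_apply, Finsupp.sum_fintype _ _ (by simp)]
  conv_lhs => rw [h4]
  simp only [Finset.sum_mul, smul_mul_assoc]
  rw [← h2, smul_zero]

end

open Polynomial in
/-- If the module induced by `ψ` is multiplicity free, then the `R(L)`-endomorphisms of the
`ψ`-eigenspace of `L ∩ N` commute. -/
theorem mul_comm_of_isMultiplicityFree {K G : Type*} [Field K] [Group G] [Fintype G] {n : ℕ}
    {R : G →* Matrix (Fin n) (Fin n) K} {N L : Subgroup G} {w u : K} {ψ : L →* Kˣ}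
    (hN : N.Normal) (hS : SchurRel R N w)
    (hC : ∀ T, (∀ g ∈ N, R g * T = T * R g) → ∃ c : K, T = c • 1)
    (hab : ∀ g h : G, (h * g)⁻¹ * (g * h) ∈ N) (hs : (X ^ Fintype.card G - 1 : K[X]).Splits)
    (hmf : IsMultiplicityFree (MonoidAlgebra K G) (IndModule L (charRep ψ)))
    {S T : Matrix (Fin n) (Fin n) K} (hSL : ∀ l ∈ L, R l * S = S * R l)
    (hSε : S * charProj R N L ψ u = S) (hTL : ∀ l ∈ L, R l * T = T * R l)
    (hTε : T * charProj R N L ψ u = T) : S * T = T * S := by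
  let e : Subring.center (MonoidAlgebra K G) := ⟨schurLift R N w 1, schurLift_one_mem_center hN⟩
  have he : IsIdempotentElem e := Subtype.ext (by
    change schurLift R N w 1 * schurLift R N w 1 = schurLift R N w 1
    rw [schurLift_mul hS, one_mul])
  -- If T commutes with R(L), then Φ(T)·generator still transforms under L by ψ, so Frobenius
  -- reciprocity gives the endomorphism. Composition of these reverses the order of the matrices.
  have hrm : ∀ T : Matrix (Fin n) (Fin n) K, (∀ l ∈ L, R l * T = T * R l) →
      ∃ f : Module.End (MonoidAlgebra K G) (IndModule L (charRep ψ)),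
        f (indGen ψ) = schurLift R N w T • indGen ψ := by
    intro T hT
    refine ⟨indHom (LinearMap.toSpanSingleton K _ (schurLift R N w T • indGen ψ)) fun l a => ?_, ?_⟩
    · rw [LinearMap.toSpanSingleton_apply, LinearMap.toSpanSingleton_apply, charRep_apply,
        smul_algebra_smul_comm, ← mul_smul (MonoidAlgebra.single _ _), single_mul_schurLift_comm hN,
        hT l l.2, mul_assoc, ← map_mul, mul_inv_cancel, map_one, mul_one,
        mul_smul (schurLift R N w T), single_smul_indGen, smul_algebra_smul_comm, smul_smul,
            mul_comm]
    · refine (indHom_indOf _ _ 1).trans ?_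
      rw [LinearMap.toSpanSingleton_apply, one_smul]
  obtain ⟨f, hf⟩ := hrm S hSL
  obtain ⟨f', hf'⟩ := hrm T hTL
  have hcomm := hmf.smul_apply_comm e he (fun P hP heP g g' => by
    obtain ⟨χ, -, φ, hφ, hφR⟩ := exists_twist_of_isSimpleModule (S := P) hN hS hab hs heP
    -- P is a twist of R by a character, and the commutant of R(N) is scalar.
    have hscal : ∀ g : Module.End (MonoidAlgebra K G) P, ∃ c : K, ∀ s, g s = c • s := by
      intro g
      let E : (Fin n → K) ≃ₗ[K] P := LinearEquiv.ofBijective φ hφ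
      let X := LinearMap.toMatrix' (E.symm.toLinearMap ∘ₗ g.restrictScalars K ∘ₗ E.toLinearMap)
      have hX : ∀ v, φ (X.mulVec v) = g (φ v) := fun v => by
        simp only [X, LinearMap.toMatrix'_mulVec]
        exact E.apply_symm_apply _
      obtain ⟨c, hc⟩ := hC X fun h hh => by
        refine Matrix.toLin'.injective (LinearMap.ext fun v => hφ.1 ?_)
        simp only [Matrix.toLin'_apply, ← Matrix.mulVec_mulVec]
        rw [hX]
        have h1 : ∀ v, φ ((R h).mulVec v) = ((χ h)⁻¹ : Kˣ).1 •
            (MonoidAlgebra.single h 1 : MonoidAlgebra K G) • φ v := fun v => by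
          rw [hφR, smul_smul, Units.inv_mul, one_smul]
        rw [h1, h1, hX, LinearMap.map_smul_of_tower, map_smul]
      refine ⟨c, fun s => ?_⟩
      obtain ⟨v, rfl⟩ := hφ.2 s
      rw [← hX, hc, Matrix.smul_mulVec, Matrix.one_mulVec, map_smul]
    obtain ⟨c, hc⟩ := hscal g
    obtain ⟨c', hc'⟩ := hscal g'
    refine LinearMap.ext fun s => ?_
    rw [Module.End.mul_apply, Module.End.mul_apply, hc, hc', hc', hc, smul_comm]) f f' (indGen ψ)
  rw [hf', hf, map_smul, map_smul, hf, hf', ← mul_smul, ← mul_smul, ← mul_smul, ← mul_smul,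
    schurLift_mul hS, schurLift_mul hS] at hcomm
  simp only [e] at hcomm
  rw [schurLift_mul hS, schurLift_mul hS, one_mul, one_mul, ← sub_eq_zero, ← sub_smul,
    ← map_sub] at hcomm
  have := mul_charProj_eq_zero (u := u) hS hcomm
  rw [sub_mul, mul_assoc, hSε, mul_assoc, hTε, sub_eq_zero] at this
  exact this.symm

open Matrix in
/-- The submodule `e Ind_L^G ψ`, `e = Φ(1)`, is generated by the image of `v ↦ Φ(v ⊗ f)`. -/
theorem schurLift_one_smul_mem {A G : Type*} [CommRing A] [Group G] [Fintype G] {n : ℕ}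
    {R : G →* Matrix (Fin n) (Fin n) A} {N L : Subgroup G} {w u : A} {ψ : L →* Aˣ}
    (hN : N.Normal) (hS : SchurRel R N w) (hu : u * Nat.card (N.subgroupOf L) = 1) {f : Fin n → A}
    (hf : ∀ g : Fin n → A, g ᵥ* charProj R N L ψ u ∈
      Submodule.span A (Set.range fun l : L => f ᵥ* (charProj R N L ψ u * R l)))
    {P : Submodule (MonoidAlgebra A G) (IndModule L (charRep ψ))}
    (hP : ∀ v, orbitMap R N w f (indGen ψ) v ∈ P) (y : IndModule L (charRep ψ)) :
    schurLift R N w 1 • y ∈ P := by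
  have hsm : ∀ (a : A) z, z ∈ P → a • z ∈ P := fun a z hz => by
    rw [← algebraMap_smul (MonoidAlgebra A G) a z]
    exact P.smul_mem _ hz
  -- By `hf` the row may be taken to be fεR(l). The factor ε is absorbed by the generator, and R(l)
  -- turns into a twist element applied to Φ(v ⊗ f)·generator.
  have h1 : ∀ v g, schurLift R N w (vecMulVec v (g ᵥ* charProj R N L ψ u)) • indGen ψ ∈ P := by
    intro v g
    have hg := hf g
    generalize g ᵥ* charProj R N L ψ u = z at hg ⊢
    induction hg using Submodule.span_induction with
    | zero => simp
    | add x y _ _ hx hy => rw [vecMulVec_add, map_add, add_smul]; exact add_mem hx hy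
    | smul a x _ hx =>
      have : vecMulVec v (a • x) = a • vecMulVec v x := by
        ext i j
        simp [vecMulVec_apply, mul_left_comm]
      rw [this, map_smul, smul_assoc]
      exact hsm _ _ hx
    | mem x hx =>
      obtain ⟨l, rfl⟩ := hx
      beta_reduce
      rw [← charProj_comm hN l]
      have : vecMulVec v (f ᵥ* (R l * charProj R N L ψ u)) =
          vecMulVec v f * R l * charProj R N L ψ u := by
        rw [← vecMul_vecMul, vecMulVec_mul, vecMulVec_mul]
      rw [this, schurLift_mul_charProj_smul_indGen hu, schurLift_mul_smul_indGen hN hS]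
      exact hsm _ _ (P.smul_mem _ (hP v))
  have h2 : schurLift R N w 1 • indGen ψ ∈ P := by
    have h3 : (1 : Matrix (Fin n) (Fin n) A) * charProj R N L ψ u =
        ∑ i, vecMulVec (Pi.single i 1) (Pi.single i 1 ᵥ* charProj R N L ψ u) := by
      simp only [← vecMulVec_mul, ← Finset.sum_mul]
      congr 1
      ext i j
      simp [Matrix.sum_apply, vecMulVec_apply, Matrix.one_apply, Pi.single_apply]
    rw [← schurLift_mul_charProj_smul_indGen hu, h3, map_sum, Finset.sum_smul]
    exact sum_mem fun i _ => h1 _ _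
  induction y using indModule_induction with
  | hadd x y hx hy => rw [smul_add]; exact add_mem hx hy
  | h g a =>
    rw [indOf_eq_smul_indGen, smul_algebra_smul_comm, smul_algebra_smul_comm, ← mul_smul,
      ← Subring.mem_center_iff.1 (schurLift_one_mem_center hN), mul_smul]
    exact hsm _ _ (P.smul_mem _ h2)

theorem IsCompositionFactor.smul_eq_zero {A S M : Type*} [Ring A] [AddCommGroup S] [Module A S]
    [AddCommGroup M] [Module A M] (h : IsCompositionFactor A S M) {a : A} (ha : ∀ m : M, a • m = 0)
    (s : S) : a • s = 0 := by
  obtain ⟨-, N₁, N₂, -, ⟨E⟩⟩ := h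
  apply E.injective
  obtain ⟨m, hm⟩ := Submodule.mkQ_surjective (N₁.submoduleOf N₂) (E s)
  rw [map_smul, ← hm, ← map_smul, show a • m = 0 from Subtype.ext (ha m), map_zero, map_zero]

/-! ### Central idempotents along the Brauer graph. -/

section Constituent

variable {O K G : Type*} [CommRing O] [Field K] [Algebra O K] [Group G]

theorem StableLattice.coe_asAlgebraHom_rep {V : Type*} [AddCommGroup V] [Module K V] [Module O V]
    [IsScalarTower O K V] {ρ : Representation K G V} (Λ : StableLattice O ρ)
    (x : MonoidAlgebra O G) (v : Λ.carrier) :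
    (Λ.rep.asAlgebraHom x v : V) =
      ρ.asAlgebraHom (MonoidAlgebra.mapRingHom G (algebraMap O K) x) v := by
  induction x using MonoidAlgebra.induction_linear with
  | zero => simp
  | add x y hx hy => rw [map_add, map_add, map_add, LinearMap.add_apply, Submodule.coe_add, hx, hy,
      LinearMap.add_apply]
  | single g a =>
    rw [MonoidAlgebra.mapRingHom_single, Representation.asAlgebraHom_single,
      Representation.asAlgebraHom_single, LinearMap.smul_apply, LinearMap.smul_apply,
      Submodule.coe_smul, algebraMap_smul]
    rfl

variable [IsLocalRing O]

theorem StableLattice.asAlgebraHom_reduction {V : Type*} [AddCommGroup V] [Module K V] [Module O V]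
    [IsScalarTower O K V] {ρ : Representation K G V} (Λ : StableLattice O ρ)
    (x : MonoidAlgebra O G) :
    Λ.reduction.asAlgebraHom (MonoidAlgebra.mapRingHom G (IsLocalRing.residue O) x) =
      (Λ.rep.asAlgebraHom x).baseChange (IsLocalRing.ResidueField O) := by
  induction x using MonoidAlgebra.induction_linear with
  | zero => simp
  | add x y hx hy => rw [map_add, map_add, map_add, LinearMap.baseChange_add, hx, hy]
  | single g a =>
    rw [MonoidAlgebra.mapRingHom_single, Representation.asAlgebraHom_single,
      Representation.asAlgebraHom_single, LinearMap.baseChange_smul]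
    exact algebraMap_smul (IsLocalRing.ResidueField O) a (Λ.reduction g)

/-- An element of `O[G]` that acts as zero on `ρ` acts as zero on the modular constituents. -/
theorem IsModularConstituent.smul_eq_zero {η : IrrRep (IsLocalRing.ResidueField O) G}
    {ρ : IrrRep K G} (h : IsModularConstituent O η ρ) {x : MonoidAlgebra O G}
    (hx : ρ.rep.asAlgebraHom (MonoidAlgebra.mapRingHom G (algebraMap O K) x) = 0)
    (s : η.rep.asModule) : MonoidAlgebra.mapRingHom G (IsLocalRing.residue O) x • s = 0 := by
  obtain ⟨Λ, hΛ⟩ := h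
  have h1 : Λ.rep.asAlgebraHom x = 0 := LinearMap.ext fun v => Subtype.ext (by
    rw [Λ.coe_asAlgebraHom_rep, hx]; rfl)
  have h2 : ∀ m : Λ.reduction.asModule,
      MonoidAlgebra.mapRingHom G (IsLocalRing.residue O) x • m = 0 := fun m => by
    apply Λ.reduction.asModuleEquiv.injective
    rw [Representation.asModuleEquiv_map_smul, Λ.asAlgebraHom_reduction, h1,
      LinearMap.baseChange_zero, LinearMap.zero_apply, map_zero]
  exact hΛ.smul_eq_zero h2 s

/-- A central idempotent acts on an irreducible representation as `0` or `1`. -/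
theorem IrrRep.asAlgebraHom_eq_zero_or_one (ρ : IrrRep K G) {e : MonoidAlgebra K G}
    (hc : e ∈ Subring.center (MonoidAlgebra K G)) (he : e * e = e) :
    ρ.rep.asAlgebraHom e = 0 ∨ ρ.rep.asAlgebraHom e = 1 := by
  have hs := (Representation.irreducible_iff_isSimpleModule_asModule ρ.rep).1 ρ.irreducible
  have hsm : ∀ v, ρ.rep.asAlgebraHom e v = e • (ρ.rep.asModuleEquiv.symm v) := fun v => rfl
  rcases eq_bot_or_eq_top (centralPart ⟨e, hc⟩ ρ.rep.asModule) with h | h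
  · left
    refine LinearMap.ext fun v => ?_
    have : e • (ρ.rep.asModuleEquiv.symm v) ∈ centralPart ⟨e, hc⟩ ρ.rep.asModule := ⟨_, rfl⟩
    rw [h, Submodule.mem_bot] at this
    exact this
  · right
    refine LinearMap.ext fun v => ?_
    obtain ⟨m, hm⟩ : ρ.rep.asModuleEquiv.symm v ∈ centralPart ⟨e, hc⟩ ρ.rep.asModule :=
      h ▸ Submodule.mem_top
    have hm' : e • m = ρ.rep.asModuleEquiv.symm v := hm
    have : e • (ρ.rep.asModuleEquiv.symm v) = ρ.rep.asModuleEquiv.symm v := by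
      rw [← hm', ← mul_smul, he]
    exact this

/-- If two irreducible representations have a common modular constituent, a central idempotent
of `O[G]` that acts as `1` on one acts as `1` on the other. -/
theorem IsModularConstituent.asAlgebraHom_eq_one {η : IrrRep (IsLocalRing.ResidueField O) G}
    {ρ σ : IrrRep K G} (hρ : IsModularConstituent O η ρ) (hσ : IsModularConstituent O η σ)
    {e : MonoidAlgebra O G} (hc : MonoidAlgebra.mapRingHom G (algebraMap O K) e ∈
      Subring.center (MonoidAlgebra K G)) (he : e * e = e)
    (h1 : ρ.rep.asAlgebraHom (MonoidAlgebra.mapRingHom G (algebraMap O K) e) = 1) :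
    σ.rep.asAlgebraHom (MonoidAlgebra.mapRingHom G (algebraMap O K) e) = 1 := by
  refine (σ.asAlgebraHom_eq_zero_or_one hc (by rw [← map_mul, he])).resolve_left fun h0 => ?_
  have := η.irreducible.toNontrivial
  have hs := (Representation.irreducible_iff_isSimpleModule_asModule η.rep).1 η.irreducible
  have := IsSimpleModule.nontrivial (MonoidAlgebra (IsLocalRing.ResidueField O) G) η.rep.asModule
  obtain ⟨s, hs⟩ := exists_ne (0 : η.rep.asModule)
  apply hs
  -- The common constituent η is killed by e, seen from σ, and by 1 − e, seen from ρ.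
  have h2 := hσ.smul_eq_zero h0 s
  have h3 := hρ.smul_eq_zero (x := 1 - e) (by rw [map_sub, map_sub, map_one, map_one, h1,
      sub_self]) s
  rwa [map_sub, map_one, sub_smul, h2, one_smul, sub_zero] at h3

end Constituent

/-! ### Twists by characters that are trivial modulo the maximal ideal. -/

section Twist

/-- The twist of a representation by a linear character. -/
def twist {K G V : Type*} [Field K] [Group G] [AddCommGroup V] [Module K V] (χ : G →* Kˣ)
    (ρ : Representation K G V) : Representation K G V where
  toFun g := (χ g : K) • ρ g
  map_one' := by simp
  map_mul' g h := by rw [map_mul, map_mul, Units.val_mul, smul_mul_smul_comm]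

@[simp]
theorem twist_apply {K G V : Type*} [Field K] [Group G] [AddCommGroup V] [Module K V] (χ : G →* Kˣ)
    (ρ : Representation K G V) (g : G) (v : V) : twist χ ρ g v = (χ g : K) • ρ g v := rfl

/-- A linear equivalence that is compatible with the action of `G`, as an equivalence of
`A[G]`-modules. -/
def toAsModuleEquiv {A G M V : Type*} [CommRing A] [Group G] [AddCommGroup M] [Module A M]
    [Module (MonoidAlgebra A G) M] [IsScalarTower A (MonoidAlgebra A G) M] [AddCommGroup V]
    [Module A V] (r : Representation A G V) (e : M ≃ₗ[A] V)
    (he : ∀ g m, e ((MonoidAlgebra.single g 1 : MonoidAlgebra A G) • m) = r g (e m)) :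
    M ≃ₗ[MonoidAlgebra A G] r.asModule where
  toFun m := r.asModuleEquiv.symm (e m)
  map_add' s t := by simp
  map_smul' x s := by
    rw [RingHom.id_apply]
    induction x using MonoidAlgebra.induction_linear with
    | zero => simp
    | add x y hx hy => rw [add_smul, map_add, map_add, hx, hy, add_smul]
    | single h a =>
      rw [← mul_one a, ← smul_eq_mul, ← MonoidAlgebra.smul_single, smul_assoc, smul_assoc, map_smul,
        map_smul, he, single_one_smul_asModule, LinearEquiv.apply_symm_apply]
  invFun v := e.symm (r.asModuleEquiv v)
  left_inv s := by simp
  right_inv s := by simp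

/-- A nonzero finite-dimensional representation has an irreducible subrepresentation. -/
theorem exists_irrRep_of_finite {k G V : Type*} [Field k] [Group G] [AddCommGroup V] [Module k V]
    [FiniteDimensional k V] [Nontrivial V] (ρ : Representation k G V) :
    ∃ η : IrrRep k G, IsCompositionFactor (MonoidAlgebra k G) η.rep.asModule ρ.asModule := by
  have : FiniteDimensional k ρ.asModule := ‹FiniteDimensional k V›
  have : Nontrivial ρ.asModule := ‹Nontrivial V›
  have : IsArtinian (MonoidAlgebra k G) ρ.asModule := isArtinian_of_tower k inferInstance
  obtain ⟨S, hS, -⟩ := (eq_bot_or_exists_atom_le (⊤ : Submodule (MonoidAlgebra k G) ρ.asModule)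
    ).resolve_left top_ne_bot
  rw [← isSimpleModule_iff_isAtom] at hS
  have : FiniteDimensional k S := inferInstanceAs (FiniteDimensional k (S.restrictScalars k))
  let e : S ≃ₗ[k] (Fin (Module.finrank k S) → k) := (Module.finBasis k S).equivFun
  let r : Representation k G (Fin (Module.finrank k S) → k) :=
    (e.conjAlgEquiv k).toMulEquiv.toMonoidHom.comp (Representation.ofModule' S)
  let E : S ≃ₗ[MonoidAlgebra k G] r.asModule := toAsModuleEquiv r e fun g m => by
    change _ = e (Representation.ofModule' S g (e.symm (e m)))
    rw [e.symm_apply_apply]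
    rfl
  have hr : IsSimpleModule (MonoidAlgebra k G) r.asModule := IsSimpleModule.congr E.symm
  refine ⟨⟨_, r, (Representation.irreducible_iff_isSimpleModule_asModule r).2 hr⟩, hr, ⊥, S, bot_le,
    ⟨E.symm.trans (Submodule.quotEquivOfEqBot _ ?_).symm⟩⟩
  exact (Submodule.comap_bot _).trans (Submodule.ker_subtype S)

variable {O K G : Type*} [CommRing O] [Field K] [Algebra O K] [Group G]

/-- A stable lattice is a stable lattice in the twists by the characters with values in `O`. -/
def StableLattice.twist {V : Type*} [AddCommGroup V] [Module K V] [Module O V] [IsScalarTower O K V]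
    {ρ : Representation K G V} (Λ : StableLattice O ρ) (χ : G →* Oˣ) :
    StableLattice O (twist ((Units.map (algebraMap O K : O →* K)).comp χ) ρ) where
  carrier := Λ.carrier
  fg := Λ.fg
  span_eq_top := Λ.span_eq_top
  stable g v hv := by
    rw [twist_apply]
    change algebraMap O K (χ g) • ρ g v ∈ Λ.carrier
    rw [algebraMap_smul]
    exact Λ.carrier.smul_mem _ (Λ.stable g v hv)

variable [IsLocalRing O]

theorem StableLattice.twist_reduction {V : Type*} [AddCommGroup V] [Module K V] [Module O V]
    [IsScalarTower O K V] {ρ : Representation K G V} (Λ : StableLattice O ρ) {χ : G →* Oˣ}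
    (hχ : ∀ g, IsLocalRing.residue O (χ g) = 1) : (Λ.twist χ).reduction = Λ.reduction := by
  refine MonoidHom.ext fun g => TensorProduct.AlgebraTensorModule.curry_injective
    (LinearMap.ext fun a => LinearMap.ext fun v => ?_)
  have h1 : (Λ.twist χ).rep g v = (χ g : O) • Λ.rep g v := Subtype.ext (algebraMap_smul K _ _)
  have h2 : ∀ v : Λ.carrier, a ⊗ₜ[O] ((χ g : O) • Λ.rep g v) = a ⊗ₜ[O] Λ.rep g v := fun v => by
    rw [← TensorProduct.smul_tmul, Algebra.smul_def]
    change (IsLocalRing.residue O (χ g) * a) ⊗ₜ[O] _ = _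
    rw [hχ, one_mul]
  exact (congrArg (fun z : Λ.carrier => a ⊗ₜ[O] z) h1).trans (h2 v)

/-- The same lattice serves both representations and has the same reduction, so any simple submodule
of the reduction joins them in the Brauer graph. -/
theorem blockOf_twist {n : ℕ} {ρ : Representation K G (Fin n → K)} (Λ : StableLattice O ρ)
    {χ : G →* Oˣ} (hχ : ∀ g, IsLocalRing.residue O (χ g) = 1) (h : ρ.IsIrreducible)
    (h' : (PNilpotent.twist ((Units.map (algebraMap O K : O →* K)).comp χ) ρ).IsIrreducible) :
    blockOf O ⟨n, _, h'⟩ = blockOf O ⟨n, ρ, h⟩ := by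
  have : Module.Finite O Λ.carrier := Module.Finite.iff_fg.2 Λ.fg
  have hΛ : ¬ Subsingleton Λ.carrier := fun hs => by
    have h0 : (Λ.carrier : Set (Fin n → K)) ⊆ {0} := fun v hv =>
      congrArg Subtype.val (Subsingleton.elim (⟨v, hv⟩ : Λ.carrier) 0)
    have h1 : (⊤ : Submodule K (Fin n → K)) = ⊥ := by
      rw [← Λ.span_eq_top, Submodule.span_eq_bot]
      exact h0
    obtain ⟨a, b, hab⟩ := h.toNontrivial
    exact hab (Subrepresentation.toSubmodule_injective
      ((eq_bot_iff.2 (le_top.trans h1.le)).trans (eq_bot_iff.2 (le_top.trans h1.le)).symm))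
  rw [← IsLocalRing.subsingleton_tensorProduct (R := O), not_subsingleton_iff_nontrivial] at hΛ
  obtain ⟨η, hη⟩ := exists_irrRep_of_finite Λ.reduction
  by_cases heq : (⟦⟨n, _, h'⟩⟧ : Irr K G) = ⟦⟨n, ρ, h⟩⟧
  · exact congrArg (brauerGraph O K G).connectedComponentMk heq
  · refine SimpleGraph.ConnectedComponent.sound (SimpleGraph.Adj.reachable
      ⟨heq, _, _, rfl, rfl, η, ⟨Λ.twist χ, ?_⟩, ⟨Λ, hη⟩⟩)
    rw [Λ.twist_reduction hχ]
    exact hη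

end Twist

/-! ### The members of the block of ρ. -/

section Supp

variable {K G : Type*} [Field K] [Group G]

theorem asAlgebraHom_intertwines {V W : Type*} [AddCommGroup V] [Module K V] [AddCommGroup W]
    [Module K W] {ρ : Representation K G V} {σ : Representation K G W} (φ : ρ.Equiv σ)
    (x : MonoidAlgebra K G) (v : V) :
    φ (ρ.asAlgebraHom x v) = σ.asAlgebraHom x (φ v) := by
  induction x using MonoidAlgebra.induction_linear with
  | zero => simp
  | add x y hx hy => rw [map_add, LinearMap.add_apply, map_add, hx, hy, map_add,
      LinearMap.add_apply]
  | single g a =>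
    rw [Representation.asAlgebraHom_single, Representation.asAlgebraHom_single,
        LinearMap.smul_apply,
      LinearMap.smul_apply, map_smul]
    exact congrArg _ (LinearMap.congr_fun (φ.toIntertwiningMap.2 g) v)

theorem asAlgebraHom_eq_one_of_equiv {V W : Type*} [AddCommGroup V] [Module K V] [AddCommGroup W]
    [Module K W] {ρ : Representation K G V} {σ : Representation K G W} (φ : ρ.Equiv σ)
    {x : MonoidAlgebra K G} (hx : ρ.asAlgebraHom x = 1) : σ.asAlgebraHom x = 1 := by
  refine LinearMap.ext fun w => ?_
  have := asAlgebraHom_intertwines φ x (φ.symm w)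
  rw [hx, Module.End.one_apply] at this
  simpa using this.symm

/-- The representation on `Kⁿ` by matrices. -/
def matrixRep {n : ℕ} (R : G →* Matrix (Fin n) (Fin n) K) : Representation K G (Fin n → K) :=
  (Matrix.toLinAlgEquiv' : Matrix (Fin n) (Fin n) K ≃ₐ[K] _).toMulEquiv.toMonoidHom.comp R

theorem matrixRep_apply {n : ℕ} (R : G →* Matrix (Fin n) (Fin n) K) (g : G) (v : Fin n → K) :
    matrixRep R g v = (R g).mulVec v := Matrix.toLinAlgEquiv'_apply _ _

theorem asAlgebraHom_matrixRep {n : ℕ} (R : G →* Matrix (Fin n) (Fin n) K) (x : MonoidAlgebra K G) :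
    (matrixRep R).asAlgebraHom x = Matrix.toLinAlgEquiv' (groupAlgebraEval R x) := by
  induction x using MonoidAlgebra.induction_linear with
  | zero => simp
  | add x y hx hy => rw [map_add, hx, hy, map_add, map_add]
  | single g a =>
    rw [Representation.asAlgebraHom_single, groupAlgebraEval, MonoidAlgebra.lift_single, map_smul]
    rfl

theorem twist_comp_subtype {V : Type*} [AddCommGroup V] [Module K V] {H : Subgroup G}
    {χ : G →* Kˣ} (hχ : ∀ h ∈ H, χ h = 1) (ρ : Representation K G V) :
    (twist χ ρ).comp H.subtype = ρ.comp H.subtype := by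
  refine MonoidHom.ext fun h => LinearMap.ext fun v => ?_
  change (χ h : K) • ρ h v = ρ h v
  rw [hχ h h.2, Units.val_one, one_smul]

variable {O : Type*} [CommRing O] [IsLocalRing O] [Algebra O K] [Fintype G] {n : ℕ}

open Polynomial in
/-- The block of `ρ` consists of the twists of `ρ` by the characters of `G ⧸ N`. -/
theorem mem_supp_blockOf_iff {p : ℕ} [Fact p.Prime] [CharP (IsLocalRing.ResidueField O) p]
    {R : G →* Matrix (Fin n) (Fin n) O} {N : Subgroup G} {w : O} (hN : N.Normal)
    (hS : SchurRel R N w) (hab : ∀ g h : G, (h * g)⁻¹ * (g * h) ∈ N)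
    (hs : (X ^ Fintype.card G - 1 : K[X]).Splits) (hinj : Function.Injective (algebraMap O K))
    (hroot : ∀ x : K, x ^ Fintype.card G = 1 → x ∈ (algebraMap O K).range)
    (hq : ∀ g : G, ∃ a, g ^ p ^ a ∈ N) {ρ : Representation K G (Fin n → K)}
    (hρ : Representation.IsIrreducible (ρ.comp N.subtype)) (Λ : StableLattice O ρ)
    (φ : (matrixRep (mapRep (algebraMap O K) R)).Equiv ρ) (x : Irr K G) :
    x ∈ (blockOf O ⟨n, ρ, irreducible_of_restrict hρ⟩).supp ↔
      ∃ χ : G →* Kˣ, (∀ h ∈ N, χ h = 1) ∧ ∃ h, x = ⟦⟨n, twist χ ρ, h⟩⟧ := by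
  have hSK := hS.map (algebraMap O K)
  rw [SimpleGraph.ConnectedComponent.mem_supp_iff]
  constructor
  · intro hx
    have hmap : MonoidAlgebra.mapRingHom G (algebraMap O K) (schurLift R N w 1) =
        schurLift (mapRep (algebraMap O K) R) N (algebraMap O K w) 1 := by
      rw [map_schurLift, map_one]
    have hρ1 : ρ.asAlgebraHom (MonoidAlgebra.mapRingHom G (algebraMap O K) (schurLift R N w 1)) =
        1 := asAlgebraHom_eq_one_of_equiv φ (by
      rw [hmap, asAlgebraHom_matrixRep, groupAlgebraEval_schurLift hSK, map_one])
    obtain ⟨W⟩ := (SimpleGraph.ConnectedComponent.exact hx).symm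
    -- That Φ(1) acts as the identity is preserved by each edge, hence along walks starting at ρ.
    have key : ∀ x y : Irr K G, (brauerGraph O K G).Reachable x y →
        (∀ σ : IrrRep K G, ⟦σ⟧ = x → σ.rep.asAlgebraHom
          (MonoidAlgebra.mapRingHom G (algebraMap O K) (schurLift R N w 1)) = 1) →
        ∀ σ : IrrRep K G, ⟦σ⟧ = y → σ.rep.asAlgebraHom
          (MonoidAlgebra.mapRingHom G (algebraMap O K) (schurLift R N w 1)) = 1 := by
      rintro x y ⟨W⟩ h
      induction W with
      | nil => exact h
      | cons hadj _ ih =>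
        refine ih fun σ hσ => ?_
        obtain ⟨-, ρ', σ', hρ', hσ', η, h1, h2⟩ := hadj
        obtain ⟨φ⟩ := Quotient.exact (hσ'.trans hσ.symm)
        refine asAlgebraHom_eq_one_of_equiv φ (h1.asAlgebraHom_eq_one h2 ?_ ?_ (h ρ' hρ'))
        · rw [hmap]
          exact schurLift_one_mem_center hN
        · rw [schurLift_mul hS, one_mul]
    induction x using Quotient.inductionOn with
    | h σ =>
    have hσ := key _ _ ⟨W⟩ (fun σ hσ => by
      obtain ⟨φ⟩ := Quotient.exact hσ.symm
      exact asAlgebraHom_eq_one_of_equiv φ hρ1) σ rfl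
    have := (Representation.irreducible_iff_isSimpleModule_asModule σ.rep).1 σ.irreducible
    obtain ⟨χ, hχ, f, hf, hfR⟩ := exists_twist_of_isSimpleModule (S := σ.rep.asModule) hN hSK hab hs
      fun s => by
        rw [← hmap]
        exact LinearMap.congr_fun hσ s
    have hirr := irreducible_of_restrict (ρ := twist χ ρ) ((twist_comp_subtype hχ ρ).symm ▸ hρ)
    refine ⟨χ, hχ, hirr, Quotient.sound ⟨Representation.Equiv.symm (Representation.Equiv.mk
      (φ.symm.toLinearEquiv.trans ((LinearEquiv.ofBijective f hf).trans σ.rep.asModuleEquiv))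
      fun g => LinearMap.ext fun v => ?_)⟩⟩
    have h1 : φ.symm (ρ g v) = (mapRep (algebraMap O K) R g).mulVec (φ.symm v) := by
      rw [← matrixRep_apply]
      exact LinearMap.congr_fun (φ.symm.toIntertwiningMap.2 g) v
    have h2 : f (φ.symm (twist χ ρ g v)) = (MonoidAlgebra.single g 1 : MonoidAlgebra K G) •
        f (φ.symm v) := by
      rw [twist_apply, map_smul, map_smul, h1, hfR]
    rw [single_one_smul_asModule] at h2
    exact h2
  · rintro ⟨χ, hχ, h, rfl⟩
    obtain ⟨χ', rfl⟩ : ∃ χ' : G →* Oˣ, χ = (Units.map (algebraMap O K : O →* K)).comp χ' := by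
      choose y hy using fun g => hroot (χ g) (by
        rw [← Units.val_pow_eq_pow_val, ← map_pow, pow_card_eq_one, map_one, Units.val_one])
      let χ' : G →* O :=
        { toFun := y
          map_one' := hinj (by rw [hy, map_one, map_one, Units.val_one])
          map_mul' := fun g h => hinj (by rw [map_mul, hy, hy, hy, map_mul, Units.val_mul]) }
      exact ⟨χ'.toHomUnits, MonoidHom.ext fun g => Units.ext (hy g).symm⟩
    refine blockOf_twist Λ (fun g => ?_) _ h
    obtain ⟨a, ha⟩ := hq g
    have h1 : (χ' g : O) ^ p ^ a = 1 := hinj (by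
      have := congrArg Units.val (hχ _ ha)
      rwa [map_pow, Units.val_pow_eq_pow_val, MonoidHom.comp_apply, Units.coe_map,
        MonoidHom.coe_coe, ← map_pow, Units.val_one, ← map_one (algebraMap O K)] at this)
    -- In characteristic p the only root of unity of p-power order is 1.
    have h2 : (IsLocalRing.residue O (χ' g) - 1) ^ p ^ a = 0 := by
      rw [sub_pow_char_pow, one_pow, ← map_pow, h1, map_one, sub_self]
    exact sub_eq_zero.1 (pow_eq_zero_iff (pow_ne_zero _ (Fact.out : p.Prime).ne_zero) |>.1 h2)

end Supp

/-! ### The block idempotent equals Φ(1). -/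

section Sum

variable {K G : Type*} [Field K] [Group G] {n : ℕ}

/-- The sum of the values at `a` of the characters of a finite commutative group. -/
theorem sum_monoidHom_apply {K Q : Type*} [Field K] [CommGroup Q] [Finite Q]
    [HasEnoughRootsOfUnity K (Monoid.exponent Q)] [Fintype (Q →* Kˣ)] [DecidableEq Q] (a : Q) :
    ∑ χ : Q →* Kˣ, (χ a : K) = if a = 1 then (Nat.card Q : K) else 0 := by
  split_ifs with h
  · subst h
    simp only [map_one, Units.val_one, Finset.sum_const, nsmul_eq_mul, mul_one, Finset.card_univ]
    rw [← Nat.card_eq_fintype_card, CommGroup.card_monoidHom_of_hasEnoughRootsOfUnity]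
  · obtain ⟨χ₀, hχ₀⟩ := CommGroup.exists_apply_ne_one_of_hasEnoughRootsOfUnity Q K h
    have h1 : (χ₀ a : K) * ∑ χ : Q →* Kˣ, (χ a : K) = ∑ χ : Q →* Kˣ, (χ a : K) := by
      rw [Finset.mul_sum]
      exact Fintype.sum_equiv (Equiv.mulLeft χ₀) _ _ fun χ => by simp
    have h2 : ((χ₀ a : K) - 1) * ∑ χ : Q →* Kˣ, (χ a : K) = 0 := by
      rw [sub_mul, h1, one_mul, sub_self]
    exact (mul_eq_zero.1 h2).resolve_left fun h3 => hχ₀ (Units.ext (sub_eq_zero.1 h3))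

theorem IrrRep.dim_ne_zero (ρ : IrrRep K G) : ρ.dim ≠ 0 := by
  intro h
  have := (Representation.irreducible_iff_isSimpleModule_asModule ρ.rep).1 ρ.irreducible
  have : Nontrivial (Fin ρ.dim → K) :=
    IsSimpleModule.nontrivial (MonoidAlgebra K G) ρ.rep.asModule
  rw [h] at this
  exact not_subsingleton (Fin 0 → K) inferInstance

theorem exists_eq_smul_one_of_equiv {N : Subgroup G} {R : G →* Matrix (Fin n) (Fin n) K} {V : Type*}
    [AddCommGroup V] [Module K V] {ρ : Representation K G V} (φ : (matrixRep R).Equiv ρ)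
    (hC : ∀ T, (∀ g ∈ N, R g * T = T * R g) → ∃ c : K, T = c • 1) (T : Module.End K V)
    (hT : ∀ g ∈ N, ρ g * T = T * ρ g) : ∃ c : K, T = c • 1 := by
  have hφ : ∀ g v, φ ((R g).mulVec v) = ρ g (φ v) := fun g v => by
    rw [← matrixRep_apply]
    exact LinearMap.congr_fun (φ.toIntertwiningMap.2 g) v
  let X := LinearMap.toMatrix' (φ.symm.toLinearEquiv.toLinearMap ∘ₗ T ∘ₗ
      φ.toLinearEquiv.toLinearMap)
  have hX : ∀ v, φ (X.mulVec v) = T (φ v) := fun v => by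
    simp only [X, LinearMap.toMatrix'_mulVec]
    exact φ.toLinearEquiv.apply_symm_apply _
  obtain ⟨c, hc⟩ := hC X fun g hg => by
    refine Matrix.toLin'.injective (LinearMap.ext fun v => φ.toLinearEquiv.injective ?_)
    simp only [Matrix.toLin'_apply, ← Matrix.mulVec_mulVec]
    change φ _ = φ _
    rw [hX, hφ, hφ, hX]
    exact LinearMap.congr_fun (hT g hg) _
  refine ⟨c, LinearMap.ext fun v => ?_⟩
  obtain ⟨v, rfl⟩ := φ.toLinearEquiv.surjective v
  refine (hX v).symm.trans ?_
  rw [hc, Matrix.smul_mulVec, Matrix.one_mulVec]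
  exact map_smul φ.toLinearEquiv c v

/-- Both characters are trivial on N, so an isomorphism of the twists commutes with ρ(N) and is a
nonzero scalar. Comparing the actions of g gives χ(g) = χ'(g). -/
theorem twist_injective {N : Subgroup G} {ρ : Representation K G (Fin n → K)} (hn : n ≠ 0)
    (hC : ∀ T : Module.End K (Fin n → K), (∀ g ∈ N, ρ g * T = T * ρ g) → ∃ c : K, T = c • 1)
    {χ χ' : G →* Kˣ} (hχ : ∀ g ∈ N, χ g = 1) (hχ' : ∀ g ∈ N, χ' g = 1)
    (φ : (twist χ ρ).Equiv (twist χ' ρ)) : χ = χ' := by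
  have hφ : ∀ g v, φ ((χ g : K) • ρ g v) = (χ' g : K) • ρ g (φ v) := fun g v =>
    LinearMap.congr_fun (φ.toIntertwiningMap.2 g) v
  obtain ⟨c, hc⟩ := hC φ.toLinearEquiv fun g hg => LinearMap.ext fun v => by
    have := hφ g v
    rw [hχ g hg, hχ' g hg, Units.val_one, one_smul, one_smul] at this
    exact this.symm
  have hc' : ∀ v, φ v = c • v := fun v => LinearMap.congr_fun hc v
  have : NeZero n := ⟨hn⟩
  obtain ⟨v, hv⟩ := exists_ne (0 : Fin n → K)
  refine MonoidHom.ext fun g => Units.ext ?_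
  have h1 := hφ g (ρ g⁻¹ v)
  rw [hc', hc', map_smul (ρ g), ← Module.End.mul_apply, ← map_mul, mul_inv_cancel, map_one,
    Module.End.one_apply, smul_smul, smul_smul, ← sub_eq_zero, ← sub_smul, mul_comm, ← sub_mul,
    smul_eq_zero, mul_eq_zero, sub_eq_zero] at h1
  rcases h1 with (h1 | h1) | h1
  · exact h1
  · refine absurd (φ.toLinearEquiv.injective (a₁ := v) (a₂ := 0) ?_) hv
    rw [map_zero]
    exact (hc' v).trans (by rw [h1, zero_smul])
  · exact absurd h1 hv

open scoped Classical in
/-- The sum of the idempotents of the twists of `ρ` by the characters of `G ⧸ N` is `Φ(1)`. -/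
theorem sum_idempotent_twist [CharZero K] [Fintype G] {N : Subgroup G} [N.Normal] {Q : Type*}
    [CommGroup Q] [Finite Q] [HasEnoughRootsOfUnity K (Monoid.exponent Q)] [Fintype (Q →* Kˣ)]
    {π : G →* Q} (hπ : ∀ g, π g = 1 ↔ g ∈ N) (hQ : Nat.card Q * Nat.card N = Fintype.card G)
    {R : G →* Matrix (Fin n) (Fin n) K} {ρ : Representation K G (Fin n → K)}
    (φ : (matrixRep R).Equiv ρ) (h : ∀ χ : Q →* Kˣ, (twist (χ.comp π) ρ).IsIrreducible) :
    ∑ χ : Q →* Kˣ, IrrRep.idempotent ⟨n, twist (χ.comp π) ρ, h χ⟩ =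
      schurLift R N ((n : K) / Nat.card N) 1 := by
  have hchar : ∀ (χ : Q →* Kˣ) g, (twist (χ.comp π) ρ).character g = (χ (π g) : K) * (R g).trace :=
      by
    intro χ g
    have h1 : (R g).trace = ρ.character g := by
      rw [← Representation.char_iso φ]
      exact (Matrix.trace_toLin'_eq _).symm
    rw [h1]
    exact map_smul (LinearMap.trace K (Fin n → K)) (χ (π g) : K) (ρ g)
  have hG : (Fintype.card G : K) = Nat.card Q * Nat.card N := by rw [← hQ, Nat.cast_mul]
  have hQ0 : (Nat.card Q : K) ≠ 0 := Nat.cast_ne_zero.2 Nat.card_pos.ne'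
  have hN0 : (Nat.card N : K) ≠ 0 := Nat.cast_ne_zero.2 Nat.card_pos.ne'
  simp only [IrrRep.idempotent, hchar]
  rw [← Finset.smul_sum, Finset.sum_comm, Finset.smul_sum, schurLift, LinearMap.coe_mk,
      AddHom.coe_mk]
  -- Character orthogonality on Q leaves only g in N, with weight n|Q|/|G| = n/|N|.
  refine Fintype.sum_equiv (Equiv.inv G) _ _ fun g => ?_
  have h1 : ∑ χ : Q →* Kˣ, (MonoidAlgebra.single g⁻¹ ((χ (π g) : K) * (R g).trace) :
      MonoidAlgebra K G) = MonoidAlgebra.single g⁻¹ ((∑ χ : Q →* Kˣ, (χ (π g) : K)) *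
        (R g).trace) := by
    rw [Finset.sum_mul]
    exact (map_sum (MonoidAlgebra.singleAddHom g⁻¹) _ _).symm
  rw [h1, sum_monoidHom_apply, MonoidAlgebra.smul_single, Equiv.inv_apply, inv_inv, mul_one,
    inv_mem_iff, hπ]
  congr 1
  split_ifs
  · rw [hG, smul_eq_mul]
    field_simp
  · rw [zero_mul, smul_zero]

open Polynomial in
/-- The idempotent of the block of `ρ` is `Φ(1)`. -/
theorem blockIdempotent_blockOf {O : Type*} [CommRing O] [IsLocalRing O] [Algebra O K] [Fintype G]
    [CharZero K] {p : ℕ} [Fact p.Prime] [CharP (IsLocalRing.ResidueField O) p]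
    {R : G →* Matrix (Fin n) (Fin n) O} {N : Subgroup G} {w : O} (hN : N.Normal)
    (hS : SchurRel R N w) (hw : algebraMap O K w = (n : K) / Nat.card N)
    (hC : ∀ T, (∀ g ∈ N, mapRep (algebraMap O K) R g * T = T * mapRep (algebraMap O K) R g) →
      ∃ c : K, T = c • 1)
    (hab : ∀ g h : G, (h * g)⁻¹ * (g * h) ∈ N) {ζ : K} (hζ : IsPrimitiveRoot ζ (Fintype.card G))
    (hinj : Function.Injective (algebraMap O K))
    (hroot : ∀ x : K, x ^ Fintype.card G = 1 → x ∈ (algebraMap O K).range)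
    (hq : ∀ g : G, ∃ a, g ^ p ^ a ∈ N) {ρ : Representation K G (Fin n → K)}
    (hρ : Representation.IsIrreducible (ρ.comp N.subtype)) (Λ : StableLattice O ρ)
    (φ : (matrixRep (mapRep (algebraMap O K) R)).Equiv ρ) :
    blockIdempotent (blockOf O ⟨n, ρ, irreducible_of_restrict hρ⟩) =
      MonoidAlgebra.mapRingHom G (algebraMap O K) (schurLift R N w 1) := by
  have hs : (X ^ Fintype.card G - 1 : K[X]).Splits := by
    simpa using X_pow_sub_one_splits hζ
  let : CommGroup (G ⧸ N) :=
    { (inferInstance : Group (G ⧸ N)) with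
      mul_comm := fun a b => by
        induction a using QuotientGroup.induction_on with
        | H a =>
        induction b using QuotientGroup.induction_on with
        | H b => exact (QuotientGroup.eq.2 (hab a b)).symm }
  have : HasEnoughRootsOfUnity K (Monoid.exponent (G ⧸ N)) := by
    have : HasEnoughRootsOfUnity K (Fintype.card G) := ⟨⟨ζ, hζ⟩, inferInstance⟩
    exact HasEnoughRootsOfUnity.of_dvd K
      ((Group.exponent_quotient_dvd N).trans Group.exponent_dvd_card)
  have := Fintype.ofFinite (G ⧸ N →* Kˣ)
  let F : (G ⧸ N →* Kˣ) → IrrRep K G := fun χ => ⟨n, twist (χ.comp (QuotientGroup.mk' N)) ρ,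
    irreducible_of_restrict (H := N) (by
      rwa [twist_comp_subtype fun h hh => by simp [(QuotientGroup.eq_one_iff h).2 hh]])⟩
  -- The block is parametrised, injectively by `hFinj`, by the characters of G ⧸ N, which turns the
  -- `finsum` into a sum over the character group.
  have hF : (blockOf O ⟨n, ρ, irreducible_of_restrict hρ⟩).supp = Set.range fun χ => (⟦F χ⟧ : Irr K
      G) := by
    ext x
    rw [mem_supp_blockOf_iff hN hS hab hs hinj hroot hq hρ Λ φ]
    constructor
    · rintro ⟨χ, hχ, h, rfl⟩
      exact ⟨QuotientGroup.lift N χ hχ, rfl⟩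
    · rintro ⟨χ, rfl⟩
      exact ⟨χ.comp (QuotientGroup.mk' N),
        fun h hh => by simp [(QuotientGroup.eq_one_iff h).2 hh], (F χ).irreducible, rfl⟩
  have hFinj : Function.Injective fun χ => (⟦F χ⟧ : Irr K G) := by
    intro χ χ' h
    obtain ⟨f⟩ := Quotient.exact h
    have hn : n ≠ 0 := (F 1).dim_ne_zero
    refine QuotientGroup.monoidHom_ext N (twist_injective hn
      (exists_eq_smul_one_of_equiv φ hC) (fun h hh => ?_) (fun h hh => ?_) f) <;>
    simp [(QuotientGroup.eq_one_iff h).2 hh]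
  rw [blockIdempotent, hF, finsum_mem_range hFinj, finsum_eq_sum_of_fintype, map_schurLift, hw,
    map_one, ← sum_idempotent_twist (Q := G ⧸ N) (π := QuotientGroup.mk' N) (fun g =>
        QuotientGroup.eq_one_iff g)
      ?_ φ fun χ => (F χ).irreducible]
  · rfl
  · rw [← Subgroup.card_eq_card_quotient_mul_card_subgroup, Nat.card_eq_fintype_card]

end Sum

/-! ### The surjection, and matrices of stable lattices. -/

/-- The surjection between the `e`-parts of induced modules that is defined by a vector `f` which
generates the `ψ`-eigenspace of `L ∩ N`. -/
theorem exists_surjective_centralPart {A G V : Type*} [CommRing A] [Group G] [Fintype G]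
    [AddCommGroup V] [Module A V] {n : ℕ} {R : G →* Matrix (Fin n) (Fin n) A} {H N L : Subgroup G}
    {w u : A} {ψ : L →* Aˣ} (hN : N.Normal) (hHN : H ≤ N) (hS : SchurRel R N w)
    (hu : u * Nat.card (N.subgroupOf L) = 1) {f : Fin n → A}
    (hf : ∀ g : Fin n → A, Matrix.vecMul g (charProj R N L ψ u) ∈
      Submodule.span A (Set.range fun l : L => Matrix.vecMul f (charProj R N L ψ u * R l)))
    {σ : Representation A H V} (E : V ≃ₗ[A] (Fin n → A))
    (hE : ∀ (h : H) v, E (σ h v) = (R h).mulVec (E v)) (e : Subring.center (MonoidAlgebra A G))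
    (he : (e : MonoidAlgebra A G) = schurLift R N w 1) :
    ∃ F : centralPart e (IndModule H σ) →ₗ[MonoidAlgebra A G]
      centralPart e (IndModule L (charRep ψ)), Function.Surjective F := by
  let F₀ : IndModule H σ →ₗ[MonoidAlgebra A G] IndModule L (charRep ψ) :=
    indHom (orbitMap R N w f (indGen ψ) ∘ₗ E.toLinearMap) fun h v => by
      rw [LinearMap.comp_apply, LinearMap.comp_apply, single_smul_orbitMap (hHN h.2),
        LinearEquiv.coe_coe, hE]
  have hmem : ∀ x ∈ centralPart e (IndModule H σ), F₀ x ∈ centralPart e (IndModule L (charRep ψ))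
      := by
    rintro _ ⟨x, rfl⟩
    exact ⟨F₀ x, (F₀.map_smul (e : MonoidAlgebra A G) x).symm⟩
  refine ⟨F₀.restrict hmem, ?_⟩
  rintro ⟨_, y, rfl⟩
  obtain ⟨x, hx⟩ := schurLift_one_smul_mem hN hS hu hf (P := LinearMap.range F₀) (fun v =>
    ⟨indOf H σ (E.symm v), by
      rw [indHom_indOf, LinearMap.comp_apply, LinearEquiv.coe_coe, E.apply_symm_apply]⟩) y
  refine ⟨⟨(e : MonoidAlgebra A G) • x, x, rfl⟩, Subtype.ext ?_⟩
  change F₀ ((e : MonoidAlgebra A G) • x) = (e : MonoidAlgebra A G) • y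
  rw [map_smul, hx, he, ← mul_smul, schurLift_mul hS, one_mul]

theorem irreducible_of_restrict_of_le {G K V : Type*} [Group G] [Field K] [AddCommGroup V]
    [Module K V] {ρ : Representation K G V} {H N : Subgroup G} (hHN : H ≤ N)
    (h : Representation.IsIrreducible (ρ.comp H.subtype)) :
    Representation.IsIrreducible (ρ.comp N.subtype) := by
  have := (irreducible_of_restrict h).toNontrivial
  refine @IsSimpleOrder.mk _ _ _ ⟨⊥, ⊤, fun hbt => ?_⟩ fun W => ?_
  · have h0 : (⊥ : Submodule K V) = ⊤ := congrArg Subrepresentation.toSubmodule hbt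
    exact bot_ne_top (Subrepresentation.toSubmodule_injective h0 : (⊥ : Subrepresentation ρ) = ⊤)
  · rcases h.eq_bot_or_eq_top ⟨W.toSubmodule, fun g _ hv =>
      W.apply_mem_toSubmodule (⟨g, hHN g.2⟩ : N) hv⟩ with hW | hW
    · left
      apply Subrepresentation.toSubmodule_injective
      exact (congrArg Subrepresentation.toSubmodule hW : W.toSubmodule = (⊥ : Submodule K V))
    · right
      apply Subrepresentation.toSubmodule_injective
      exact (congrArg Subrepresentation.toSubmodule hW : W.toSubmodule = (⊤ : Submodule K V))

section Lattice

variable {O K G : Type*} [CommRing O] [Field K] [Algebra O K] [Group G] {n : ℕ}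

/-- The matrices of a stable lattice. -/
theorem StableLattice.exists_matrix [IsDomain O] [IsPrincipalIdealRing O] [IsFractionRing O K]
    {ρ : Representation K G (Fin n → K)} (Λ : StableLattice O ρ) :
    ∃ (R : G →* Matrix (Fin n) (Fin n) O) (E : Λ.carrier ≃ₗ[O] (Fin n → O)),
      (∀ g v, E (Λ.rep g v) = (R g).mulVec (E v)) ∧
      Nonempty ((matrixRep (mapRep (algebraMap O K) R)).Equiv ρ) := by
  have : Submodule.IsLattice K Λ.carrier := ⟨Λ.fg, Λ.span_eq_top⟩
  have : Module.IsTorsionFree O K := inferInstance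
  have : Module.Free O Λ.carrier := Submodule.IsLattice.free K Λ.carrier
  let b : Module.Basis (Fin n) O Λ.carrier := Module.finBasisOfFinrankEq O Λ.carrier (by
    rw [Submodule.IsLattice.finrank_of_pi K, Fintype.card_fin])
  let R : G →* Matrix (Fin n) (Fin n) O :=
    (LinearMap.toMatrixAlgEquiv b).toMulEquiv.toMonoidHom.comp Λ.rep
  have hR : ∀ g v, b.equivFun (Λ.rep g v) = (R g).mulVec (b.equivFun v) := fun g v => by
    exact (LinearMap.toMatrix_mulVec_repr b b (Λ.rep g) v).symm
  let B := b.extendOfIsLattice K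
  have hB : ∀ i, B i = (b i : Fin n → K) := fun i => b.extendOfIsLattice_apply K i
  refine ⟨R, b.equivFun, hR, ⟨Representation.Equiv.mk B.equivFun.symm fun g => ?_⟩⟩
  refine (Pi.basisFun K (Fin n)).ext fun j => ?_
  rw [LinearMap.comp_apply, LinearMap.comp_apply, matrixRep_apply, Pi.basisFun_apply,
    Matrix.mulVec_single_one]
  have h1 := congrArg (Subtype.val ∘ b.equivFun.symm) (hR g (b j))
  simp only [Function.comp_apply, LinearEquiv.symm_apply_apply] at h1
  have h2 : b.equivFun (b j) = Pi.single j 1 := by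
    ext i
    simp [Pi.single_apply, eq_comm]
  have h3 : B.equivFun.symm (Pi.single j 1) = B j := by simp
  change B.equivFun.symm _ = ρ g (B.equivFun.symm (Pi.single j 1))
  rw [h3, hB]
  refine Eq.trans ?_ h1.symm
  rw [h2, Matrix.mulVec_single_one, Module.Basis.equivFun_symm_apply,
    Module.Basis.equivFun_symm_apply, Submodule.coe_sum]
  refine Finset.sum_congr rfl fun i _ => ?_
  rw [hB, Submodule.coe_smul, ← algebraMap_smul K ((R g).col j i)]
  rfl

/-- An idempotent over `O` that commutes with an irreducible representation is trivial. -/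
theorem eq_zero_or_one_of_isIdempotentElem {R : G →* Matrix (Fin n) (Fin n) O} {N : Subgroup G}
    {ρ : Representation K G (Fin n → K)} (hinj : Function.Injective (algebraMap O K))
    (hρ : Representation.IsIrreducible (ρ.comp N.subtype))
    (φ : (matrixRep (mapRep (algebraMap O K) R)).Equiv ρ) {e : Matrix (Fin n) (Fin n) O}
    (he : IsIdempotentElem e) (hc : ∀ g ∈ N, R g * e = e * R g) : e = 0 ∨ e = 1 := by
  let e' := e.map (algebraMap O K)
  have he' : e' * e' = e' := by rw [← Matrix.map_mul, he]
  have hc' : ∀ g ∈ N, mapRep (algebraMap O K) R g * e' = e' * mapRep (algebraMap O K) R g := by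
    intro g hg
    rw [mapRep_apply, ← Matrix.map_mul, ← Matrix.map_mul, hc g hg]
  have hφ : ∀ g v, φ.symm (ρ g v) = (mapRep (algebraMap O K) R g).mulVec (φ.symm v) := fun g v => by
    rw [← matrixRep_apply]
    exact LinearMap.congr_fun (φ.symm.toIntertwiningMap.2 g) v
  -- The kernel of the idempotent, transported to ρ, is N-stable, so it is zero or everything.
  let W : Subrepresentation (ρ.comp N.subtype) :=
    ⟨LinearMap.ker (e'.mulVecLin ∘ₗ φ.symm.toLinearEquiv.toLinearMap), fun g v hv => by
      have hv' : e'.mulVec (φ.symm v) = 0 := hv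
      change e'.mulVec (φ.symm (ρ g v)) = 0
      rw [hφ, Matrix.mulVec_mulVec, ← hc' g g.2, ← Matrix.mulVec_mulVec, hv', Matrix.mulVec_zero]⟩
  have hmap : Function.Injective fun M : Matrix (Fin n) (Fin n) O => M.map (algebraMap O K) :=
    Matrix.map_injective hinj
  rcases hρ.eq_bot_or_eq_top W with hW | hW
  · right
    have hW' : LinearMap.ker (e'.mulVecLin ∘ₗ φ.symm.toLinearEquiv.toLinearMap) = ⊥ :=
      congrArg Subrepresentation.toSubmodule hW
    have h1 : ∀ v, e'.mulVec v = v := fun v => by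
      have h2 : φ (e'.mulVec v - v) ∈
          LinearMap.ker (e'.mulVecLin ∘ₗ φ.symm.toLinearEquiv.toLinearMap) := by
        change e'.mulVec (φ.symm (φ _)) = 0
        rw [φ.symm_apply_apply, Matrix.mulVec_sub, Matrix.mulVec_mulVec, he', sub_self]
      rw [hW', Submodule.mem_bot] at h2
      exact sub_eq_zero.1 (φ.toLinearEquiv.injective (h2.trans (map_zero φ.toLinearEquiv).symm))
    apply hmap
    change e' = Matrix.map 1 _
    rw [Matrix.map_one _ (map_zero _) (map_one _)]
    exact Matrix.toLin'.injective (LinearMap.ext fun v => by simpa using h1 v)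
  · left
    have hW' : LinearMap.ker (e'.mulVecLin ∘ₗ φ.symm.toLinearEquiv.toLinearMap) = ⊤ :=
      congrArg Subrepresentation.toSubmodule hW
    have h1 : ∀ v, e'.mulVec v = 0 := fun v => by
      have h2 : φ v ∈ LinearMap.ker (e'.mulVecLin ∘ₗ φ.symm.toLinearEquiv.toLinearMap) :=
        hW' ▸ Submodule.mem_top
      have h3 : e'.mulVec (φ.symm (φ v)) = 0 := h2
      rwa [φ.symm_apply_apply] at h3
    apply hmap
    change e' = Matrix.map 0 _
    rw [Matrix.map_zero _ (map_zero _)]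
    exact Matrix.toLin'.injective (LinearMap.ext fun v => by simpa using h1 v)

end Lattice

/-! ### Topology of the valuation ring, roots of unity, and the quotient G ⧸ N. -/

section LocalField

variable {K : Type*} [Field K] [ValuativeRel K] [TopologicalSpace K] [IsNonarchimedeanLocalField K]

variable (K) in
theorem t2Space_of_isNonarchimedeanLocalField : T2Space K := by
  let := IsTopologicalAddGroup.rightUniformSpace K
  have := isUniformAddGroup_of_addCommGroup (G := K)
  infer_instance

/-- The maximal ideal is ϖO, a continuous image of a compact space. -/
theorem isClosed_maximalIdeal {O : Type*} [CommRing O] [IsDomain O] [IsDiscreteValuationRing O]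
    [TopologicalSpace O] [IsTopologicalRing O] [CompactSpace O] [T2Space O] :
    IsClosed (IsLocalRing.maximalIdeal O : Set O) := by
  obtain ⟨ϖ, hϖ⟩ := IsDiscreteValuationRing.exists_irreducible O
  have : (IsLocalRing.maximalIdeal O : Set O) = Set.range fun x => ϖ * x := by
    ext x
    rw [hϖ.maximalIdeal_eq, SetLike.mem_coe, Ideal.mem_span_singleton]
    exact ⟨fun ⟨y, hy⟩ => ⟨y, hy.symm⟩, fun ⟨y, hy⟩ => ⟨y, hy.symm⟩⟩
  rw [this]
  exact (isCompact_range (continuous_const.mul continuous_id)).isClosed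

end LocalField

section IntegrallyClosed

variable {O K : Type*} [CommRing O] [Field K] [Algebra O K] [IsFractionRing O K]
  [IsIntegrallyClosed O]

theorem mem_range_algebraMap_of_pow_eq_one {m : ℕ} (hm : m ≠ 0) {x : K} (hx : x ^ m = 1) :
    x ∈ (algebraMap O K).range :=
  IsIntegrallyClosed.isIntegral_iff.1 (IsIntegral.of_pow (Nat.pos_of_ne_zero hm) (hx ▸
      isIntegral_one))

open Polynomial in
/-- If `K` contains the `m`-th roots of unity, then `X ^ m - 1` splits over the quotients of `O`. -/
theorem splits_X_pow_sub_one_map [IsDomain O] {m : ℕ} (hm : m ≠ 0) {ζ : K} (hζ : IsPrimitiveRoot ζ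
    m) {k : Type*}
    [Field k] (f : O →+* k) : (X ^ m - 1 : k[X]).Splits := by
  obtain ⟨z, rfl⟩ := mem_range_algebraMap_of_pow_eq_one (O := O) hm hζ.pow_eq_one
  have hz : IsPrimitiveRoot z m := hζ.of_map_of_injective (IsFractionRing.injective O K)
  have h1 : (X ^ m - 1 : k[X]) = (X ^ m - 1 : O[X]).map f := by simp
  rw [h1, X_pow_sub_one_eq_prod (Nat.pos_of_ne_zero hm) hz, Polynomial.map_prod]
  refine Splits.prod fun a _ => ?_
  rw [Polynomial.map_sub, map_X, map_C]
  exact Splits.X_sub_C _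

end IntegrallyClosed

section Group

variable {G : Type*} [Group G] {N : Subgroup G} [N.Normal]

/-- A subgroup of a group `G` such that `G ⧸ N` is cyclic is generated modulo `N` by one element. -/
theorem exists_forall_pow_inv_mul_mem [Finite G] [IsCyclic (G ⧸ N)] (L : Subgroup G) :
    ∃ c : L, ∀ l : L, ∃ j : ℕ, ((c : G) ^ j)⁻¹ * l ∈ N := by
  let f : L →* G ⧸ N := (QuotientGroup.mk' N).comp L.subtype
  obtain ⟨⟨_, c, rfl⟩, hc⟩ := IsCyclic.exists_generator (α := f.range)
  refine ⟨c, fun l => ?_⟩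
  obtain ⟨j, hj⟩ := mem_powers_iff_mem_zpowers.2 (hc ⟨f l, l, rfl⟩)
  refine ⟨j, QuotientGroup.eq.1 ?_⟩
  exact congrArg Subtype.val hj

theorem commutator_mem_of_isCyclic [IsCyclic (G ⧸ N)] (g h : G) : (h * g)⁻¹ * (g * h) ∈ N :=
  QuotientGroup.eq.1 (by
    let := IsCyclic.commGroup (α := G ⧸ N)
    exact mul_comm (h : G ⧸ N) (g : G ⧸ N))

end Group

theorem isUnit_natCast_of_coprime {p : ℕ} [Fact p.Prime] {O : Type*} [CommRing O] [IsLocalRing O]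
    [CharP (IsLocalRing.ResidueField O) p] {m : ℕ} (hm : m.Coprime p) : IsUnit (m : O) := by
  rw [← IsLocalRing.residue_ne_zero_iff_isUnit, map_natCast, Ne, CharP.cast_eq_zero_iff _ p]
  exact fun h => (Nat.Prime.coprime_iff_not_dvd Fact.out).1 hm.symm h

theorem card_subgroupOf_dvd {G : Type*} [Group G] (N L : Subgroup G) : Nat.card (N.subgroupOf L) ∣
    Nat.card N := by
  rw [← Subgroup.card_map_of_injective L.subtype_injective, Subgroup.subgroupOf_map_subtype]
  exact Subgroup.card_dvd_of_le inf_le_left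

/-! ### Assembly of the proof. -/

open Polynomial in
/-- The commutant of `R(N)` over `K` consists of scalars. -/
theorem exists_eq_smul_one_of_commute_algebraMap {O K G : Type*} [CommRing O] [IsDomain O]
    [IsDiscreteValuationRing O] [TopologicalSpace O] [IsTopologicalRing O] [CompactSpace O]
    [T2Space O] [Finite (IsLocalRing.ResidueField O)] [Field K] [Algebra O K] [IsFractionRing O K]
    [Group G] [Fintype G] {n : ℕ} {ζ : K} (hζ : IsPrimitiveRoot ζ (Fintype.card G))
    {N : Subgroup G} (hN : IsUnit (Nat.card N : O)) {ρ : Representation K G (Fin n → K)}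
    (hρ : Representation.IsIrreducible (ρ.comp N.subtype)) {R : G →* Matrix (Fin n) (Fin n) O}
    (φ : (matrixRep (mapRep (algebraMap O K) R)).Equiv ρ) (T : Matrix (Fin n) (Fin n) K)
    (hT : ∀ g ∈ N, mapRep (algebraMap O K) R g * T = T * mapRep (algebraMap O K) R g) :
    ∃ c : K, T = c • 1 := by
  have := Fintype.ofFinite N
  have hinj := IsFractionRing.injective O K
  obtain ⟨q, hq⟩ := N.card_subgroup_dvd_card
  rw [Nat.card_eq_fintype_card (α := G)] at hq
  have hζN : IsPrimitiveRoot (ζ ^ q) (Nat.card N) :=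
    hζ.pow Fintype.card_pos (hq.trans (mul_comm _ _))
  have hn : n ≠ 0 := IrrRep.dim_ne_zero ⟨n, ρ, irreducible_of_restrict hρ⟩
  refine exists_eq_smul_one_of_commute_map (R := R.comp N.subtype) (fun S hS => ?_) fun g => hT g
      g.2
  refine exists_eq_smul_one_of_commute isClosed_maximalIdeal hn (R.comp N.subtype) ?_
    (splits_X_pow_sub_one_map Nat.card_pos.ne' hζN (IsLocalRing.residue O)) ?_ hS
  · rwa [← Nat.card_eq_fintype_card]
  · exact fun e he hc => eq_zero_or_one_of_isIdempotentElem hinj hρ φ he fun g hg => hc ⟨g, hg⟩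

set_option maxHeartbeats 800000 in
open Polynomial in
/-- The block idempotent is integral, and there is a surjection between the block components of the
induced modules. -/
theorem exists_center_and_surjective {O K G : Type*} [CommRing O] [IsDomain O]
    [IsDiscreteValuationRing O] [TopologicalSpace O] [IsTopologicalRing O] [CompactSpace O]
    [T2Space O] [Finite (IsLocalRing.ResidueField O)] [Field K] [CharZero K] [Algebra O K]
    [IsFractionRing O K] {p : ℕ} [Fact p.Prime] [CharP (IsLocalRing.ResidueField O) p]
    [Group G] [Fintype G] {n : ℕ} {ζ : K} (hζ : IsPrimitiveRoot ζ (Fintype.card G))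
    {N : Subgroup G} (hN : N.Normal) (hpN : (Nat.card N).Coprime p)
    {P : Sylow p G} (hP : IsCyclic P) (hNP : N.IsComplement' (P : Subgroup G))
    {H : Subgroup G} (hHN : H ≤ N) {ρ : Representation K G (Fin n → K)}
    (hρ : Representation.IsIrreducible (ρ.comp H.subtype)) (Λ : StableLattice O ρ)
    {L : Subgroup G} (ψ : L →* Oˣ)
    (hmf : IsMultiplicityFree (MonoidAlgebra K G)
      (IndModule L (charRep ((Units.map (algebraMap O K : O →* K)).comp ψ)))) :
    ∃ e : Subring.center (MonoidAlgebra O G),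
      MonoidAlgebra.mapRingHom G (algebraMap O K) e =
        blockIdempotent (blockOf O ⟨n, ρ, irreducible_of_restrict hρ⟩) ∧
      ∃ f : centralPart e (IndModule H (Λ.rep.comp H.subtype)) →ₗ[MonoidAlgebra O G]
            centralPart e (IndModule L (charRep ψ)), Function.Surjective f := by
  have hinj := IsFractionRing.injective O K
  have hρN := irreducible_of_restrict_of_le hHN hρ
  obtain ⟨R, E, hE, ⟨φ⟩⟩ := Λ.exists_matrix
  obtain ⟨a, ha⟩ := isUnit_natCast_of_coprime (O := O) hpN
  have hC := exists_eq_smul_one_of_commute_algebraMap hζ ⟨a, ha⟩ hρN φ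
  have hw : algebraMap O K (n * (a⁻¹ : Oˣ)) = (n : K) / Nat.card N := by
    rw [map_mul, map_natCast, div_eq_mul_inv, ← map_natCast (algebraMap O K) (Nat.card N), ← ha]
    congr 1
    refine eq_inv_of_mul_eq_one_left ?_
    rw [← map_mul, Units.inv_mul, map_one]
  have hS : SchurRel R N (n * (a⁻¹ : Oˣ)) := by
    refine SchurRel.of_map (algebraMap O K) hinj ?_
    rw [hw]
    exact schurRel_of_commute hC
  obtain ⟨b, hb⟩ := isUnit_natCast_of_coprime (O := O) (p := p) (m := Nat.card (N.subgroupOf L))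
    (hpN.coprime_dvd_left (card_subgroupOf_dvd N L))
  have hu : ((b⁻¹ : Oˣ) : O) * Nat.card (N.subgroupOf L) = 1 := by rw [← hb, Units.inv_mul]
  let eqv : G ⧸ N ≃* P := hNP.symm.QuotientMulEquiv
  have hcyc : IsCyclic (G ⧸ N) := isCyclic_of_surjective eqv.symm eqv.symm.surjective
  have hab : ∀ g h : G, (h * g)⁻¹ * (g * h) ∈ N := commutator_mem_of_isCyclic
  have hq : ∀ g : G, ∃ a, g ^ p ^ a ∈ N := fun g => by
    obtain ⟨a, ha⟩ := P.isPGroup' (eqv g)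
    refine ⟨a, (QuotientGroup.eq_one_iff _).1 (eqv.injective ?_)⟩
    rw [QuotientGroup.mk_pow, map_pow, ha, map_one]
  have hs : (X ^ Fintype.card G - 1 : K[X]).Splits := by
    simpa using X_pow_sub_one_splits hζ
  obtain ⟨c, hc⟩ := exists_forall_pow_inv_mul_mem (N := N) L
  obtain ⟨f, hf⟩ := exists_vecMul_charProj_mem_span (ψ := ψ) hN hS hu hc (hq c)
    fun S T hSL _ hSε hTL _ hTε => by
      -- Commutativity is checked in M_n(K), where multiplicity freeness applies.
      have hmap : Function.Injective fun M : Matrix (Fin n) (Fin n) O => M.map (algebraMap O K) :=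
        Matrix.map_injective hinj
      apply hmap
      dsimp only
      rw [Matrix.map_mul, Matrix.map_mul]
      have hL : ∀ S : Matrix (Fin n) (Fin n) O, (∀ l ∈ L, R l * S = S * R l) → ∀ l ∈ L,
          mapRep (algebraMap O K) R l * S.map (algebraMap O K) =
            S.map (algebraMap O K) * mapRep (algebraMap O K) R l := fun S h l hl => by
        rw [mapRep_apply, ← Matrix.map_mul, ← Matrix.map_mul, h l hl]
      have hε : ∀ S : Matrix (Fin n) (Fin n) O, S * charProj R N L ψ ((b⁻¹ : Oˣ) : O) = S →
          S.map (algebraMap O K) * charProj (mapRep (algebraMap O K) R) N L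
            ((Units.map (algebraMap O K : O →* K)).comp ψ) (algebraMap O K (b⁻¹ : Oˣ)) =
              S.map (algebraMap O K) := fun S h => by
        rw [← charProj_map, ← Matrix.map_mul, h]
      exact mul_comm_of_isMultiplicityFree hN (hS.map (algebraMap O K)) hC hab hs hmf
        (hL S hSL) (hε S hSε) (hL T hTL) (hε T hTε)
  refine ⟨⟨_, schurLift_one_mem_center hN⟩, (blockIdempotent_blockOf hN hS hw hC hab hζ hinj
    (fun x hx => mem_range_algebraMap_of_pow_eq_one Fintype.card_ne_zero hx) hq hρN Λ φ).symm, ?_⟩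
  exact exists_surjective_centralPart hN hHN hS hu hf E (fun h v => hE h v) _ rfl

end

end PNilpotent

theorem mainTheorem6 (p : ℕ) (hp : p.Prime)
    {K : Type*} [Field K] [ValuativeRel K] [TopologicalSpace K] [IsNonarchimedeanLocalField K]
    [CharZero K] [CharP 𝓀[K] p]
    {G : Type*} [Group G] [Fintype G]
    (hK : ∃ ζ : K, IsPrimitiveRoot ζ (Fintype.card G))
    (N : Subgroup G) (hN : N.Normal) (hpN : (Nat.card N).Coprime p)
    (P : Sylow p G) (hP : IsCyclic P) (hNP : N.IsComplement' (P : Subgroup G))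
    (H : Subgroup G) (hHN : H ≤ N)
    {n : ℕ} (ρ : Representation K G (Fin n → K))
    (hρ : Representation.IsIrreducible (ρ.comp H.subtype))
    (Λ : PNilpotent.StableLattice 𝒪[K] ρ)
    (L : Subgroup G) (ψ : L →* (𝒪[K])ˣ) (hψ : (orderOf ψ).Coprime p)
    (hmf : PNilpotent.IsMultiplicityFree (MonoidAlgebra K G)
      (PNilpotent.IndModule L
        (PNilpotent.charRep ((Units.map (algebraMap 𝒪[K] K : 𝒪[K] →* K)).comp ψ)))) :
    ∃ e : Subring.center (MonoidAlgebra 𝒪[K] G),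
      MonoidAlgebra.mapRingHom G (algebraMap 𝒪[K] K) e =
        PNilpotent.blockIdempotent (PNilpotent.blockOf 𝒪[K]
          ⟨n, ρ, PNilpotent.irreducible_of_restrict hρ⟩) ∧
      ∃ f : PNilpotent.centralPart e (PNilpotent.IndModule H (Λ.rep.comp H.subtype))
          →ₗ[MonoidAlgebra 𝒪[K] G]
            PNilpotent.centralPart e (PNilpotent.IndModule L (PNilpotent.charRep ψ)),
        Function.Surjective f := by
  have : Fact p.Prime := ⟨hp⟩
  have := PNilpotent.t2Space_of_isNonarchimedeanLocalField K
  obtain ⟨ζ, hζ⟩ := hK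
  exact PNilpotent.exists_center_and_surjective hζ hN hpN hP hNP hHN hρ Λ ψ hmf
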